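/- **Setting.** Let $A=(a_{pq})_{p,q\in P}$ be an indecomposable generalized Cartan matrix of affine type ($P$ finite) which is simply laced, i.e. $a_{pq}\in\{0,-1\}$ for $p\neq q$. Let $\Gamma$ be its Dynkin diagram, in which $p\ne q$ are adjacent iff $a_{pq}\neq 0$. Let $\delta=\sum_p\delta_p\alpha_p$ be the vector with relatively prime positive integer coefficients and $A\delta=0$, let $o\in P$ be a vertex with $\delta_o=1$, and let $A_0$ be the (finite type) matrix obtained from $A$ by deleting the row and column of $o$. Write $\langle\alpha_q,\alpha_p^\vee\rangle=a_{pq}$. Fix an orientation of $\Gamma$ and put $\operatorname{sgn}(p,q)=-1$ if $p=q$ or there is an arrow from $p$ to $q$, and $\operatorname{sgn}(p,q)=1$ otherwise. **Full heaps.** A *full heap* over $\Gamma$ is a locally finite poset $E$ with a map $\varepsilon:E\to P$ such that: (1) elements whose labels are equal or adjacent are comparable, and $\le$ is the transitive closure of its restriction to pairs with equal or adjacent labels; (2) each $\varepsilon^{-1}(p)$ is nonempty and unbounded above and below, and if $p,p'$ are adjacent and $\varepsilon(x)=p$ then some $y$ with $\varepsilon(y)=p'$ covers or is covered by $x$; (3)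 if $x<y$, $\varepsilon(x)=\varepsilon(y)=p$ and no element of the open interval $(x,y)$ has label $p$, then $\sum_{z\in(x,y)}a_{p,\varepsilon(z)}=-2$. **Operators.** A *proper ideal* of $E$ is a lower set $I$ such that, for every $p$, some but not all elements labelled $p$ lie in $I$. Let $k$ be a field of characteristic $\ne2$ and $V_E$ the $k$-vector space with basis $\{v_I\}$, $I$ running over the proper ideals. For a finite convex $L\subseteq E$ write $L\succ I$ if $I\cap L=\emptyset$ and $I\cup L$ is an ideal, and $L\prec I$ if $L\subseteq I$ and $I\setminus L$ is an ideal. Let $X_Lv_I=v_{I\cup L}$ if $L\succ I$ and $0$ otherwise; $Y_Lv_I=v_{I\setminus L}$ if $L\prec I$ and $0$ otherwise; $H_Lv_I$ equal to $v_I$ if $L\prec I$ and $L\not\succ I$, to $-v_I$ if $L\succ I$ and $L\not\prec I$, and to $0$ otherwise. For $\chi:P\to\mathbb Z_{\ge0}$ let $\mathcal L_\chi$ be the set of finite convex subsets of $E$ with exactly $\chi(p)$ elements labelled $p$ for each $p$; let $\operatorname{sgn}(L)=\prod_{x,y\in L,\,x>y}\operatorname{sgn}(\varepsilon(x),\varepsilon(y))$,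 and $$X_\chi=\sum_{L\in\mathcal L_\chi}\operatorname{sgn}(L)X_L,\qquad Y_\chi=\sum_{L\in\mathcal L_\chi}\operatorname{sgn}(L)Y_L,\qquad H_\chi=\sum_{L\in\mathcal L_\chi}H_L,$$ the sums being taken on each basis vector. For $p\in P$ let $X_p,Y_p,H_p$ be the unsigned sums of $X_L,Y_L,H_L$ over the one-element sets $L$ labelled $p$. **Chevalley basis.** Let $\Delta$ be the root system of $A_0$ (the vectors $w(\alpha_i)$, with $w$ in the Weyl group of $A_0$ and $i\neq o$), and let $\epsilon(\beta,\gamma)=\prod_{i,j}\operatorname{sgn}(i,j)^{\beta_i\gamma_j}$. Let $\mathfrak g_0$ be the complex simple Lie algebra with Cartan matrix $A_0$, realised with basis $\{\alpha_i^\vee\}_{i\ne o}\cup\{E_\beta\}_{\beta\in\Delta}$ and bracket $[h,h']=0$ and $[h,E_\beta]=\langle\beta,h\rangle E_\beta$ for $h,h'$ in the span of the $\alpha_i^\vee$, $[E_\beta,E_{-\beta}]=-\beta^\vee$, $[E_\beta,E_\gamma]=\epsilon(\beta,\gamma)E_{\beta+\gamma}$ if $\beta+\gamma\in\Delta$, and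 $[E_\beta,E_\gamma]=0$ if $\beta+\gamma\notin\Delta\cup\{0\}$. Its Chevalley generators are $e_i=E_{\alpha_i}$, $f_i=-E_{-\alpha_i}$, $h_i=\alpha_i^\vee$. **Proposition 5.4.** Let $E$ be a full heap over $\Gamma$ and let $\alpha=\sum_{i\neq o}\lambda_i\alpha_i$ be a positive root of $A_0$, regarded also as the function $i\mapsto\lambda_i$, $o\mapsto0$ on $P$. Then: (i) $\mathcal L_\alpha\neq\emptyset$ (the root $\alpha$ is representable in $E$). (ii) $X_\alpha$ is nonzero and lies in the Lie algebra generated by the $X_p$, $p\in P$; when $k=\mathbb C$ it equals $E_\alpha$. (iii) $[H_p,X_\alpha]=\langle\alpha,\alpha_p^\vee\rangle X_\alpha$ for every vertex $p$ of $\Gamma$. (iv) $Y_\alpha$ is nonzero and lies in the Lie algebra generated by the $Y_p$, $p\in P$; when $k=\mathbb C$ it equals $-E_{-\alpha}$. (v) $[H_p,Y_\alpha]=-\langle\alpha,\alpha_p^\vee\rangle Y_\alpha$ for every vertex $p$ of $\Gamma$. (vi) For no proper ideal $I$ of $E$ do there exist $L,L'\in\mathcal L_\alpha$ with $L\succ I$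 and $L'\prec I$. (vii) $H_\alpha=\sum_i\lambda_iH_i=\alpha^\vee$, where $\alpha^\vee=w(\alpha_i^\vee)$ if $\alpha=w(\alpha_i)$, and an element $\sum_jc_j\alpha_j^\vee$ is regarded as the operator $\sum_jc_jH_j$. The equalities with $E_\alpha$ and $-E_{-\alpha}$ in (ii) and (iv) mean: for $k=\mathbb C$ there is exactly one Lie algebra homomorphism $\psi$ from $\mathfrak g_0$ to the operators on $V_E$ with $\psi(e_i)=X_i$, $\psi(f_i)=Y_i$, $\psi(h_i)=H_i$ for all $i\neq o$; it is injective, and $\psi(E_\alpha)=X_\alpha$, $\psi(-E_{-\alpha})=Y_\alpha$. -/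

import Mathlib

attribute [local instance] LieRing.ofAssociativeRing

noncomputable section

namespace FullHeapRep

/-! ### Generalized Cartan matrices and Dynkin diagrams -/

/-- Generalized Cartan matrices. -/
structure IsGeneralizedCartanMatrix {P : Type*} (A : Matrix P P ℤ) : Prop where
  diag : ∀ i, A i i = 2
  nonpos : ∀ i j, i ≠ j → A i j ≤ 0
  zero_iff : ∀ i j, A i j = 0 ↔ A j i = 0

/-- The underlying graph of the Dynkin diagram of `A`. In the simply laced case there are no
multiple edges, so this graph is the whole diagram. -/
def dynkinGraph {P : Type*} (A : Matrix P P ℤ) : SimpleGraph P where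
  Adj p q := p ≠ q ∧ (A p q ≠ 0 ∨ A q p ≠ 0)
  symm := ⟨fun _ _ h => ⟨h.1.symm, h.2.symm⟩⟩
  loopless := ⟨fun _ h => h.1 rfl⟩

/-- Indecomposable matrices of affine type: corank one, a strictly positive null vector, and
`A v ≥ 0` implies `A v = 0` (real vectors). -/
structure IsAffineType {P : Type*} [Fintype P] (A : Matrix P P ℤ) : Prop where
  connected : (dynkinGraph A).Connected
  corank_one : (A.map (Int.cast : ℤ → ℝ)).rank + 1 = Fintype.card P
  exists_pos : ∃ u : P → ℝ, (∀ i, 0 < u i) ∧ (A.map (Int.cast : ℤ → ℝ)).mulVec u = 0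
  null_of_nonneg : ∀ v : P → ℝ, (∀ i, 0 ≤ (A.map (Int.cast : ℤ → ℝ)).mulVec v i) →
    (A.map (Int.cast : ℤ → ℝ)).mulVec v = 0

/-- `δ = ∑ aᵢ αᵢ` is the vector with relatively prime positive integer coefficients such that
`A δ = 0`. -/
structure IsNullRoot {P : Type*} [Fintype P] (A : Matrix P P ℤ) (δ : P → ℤ) : Prop where
  pos : ∀ i, 0 < δ i
  null : A.mulVec δ = 0
  gcd_eq_one : Finset.univ.gcd δ = 1

/-- The matrix obtained from `A` by deleting the row and column of the vertex `o`. -/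
def deleteVertex {P : Type*} (A : Matrix P P ℤ) (o : P) :
    Matrix {p : P // p ≠ o} {p : P // p ≠ o} ℤ :=
  A.submatrix Subtype.val Subtype.val

/-- An orientation of the Dynkin diagram: each edge carries exactly one arrow. -/
structure IsOrientation {P : Type*} (A : Matrix P P ℤ) (arrow : P → P → Prop) : Prop where
  adj_of_arrow : ∀ p q, arrow p q → (dynkinGraph A).Adj p q
  xor_of_adj : ∀ p q, (dynkinGraph A).Adj p q → Xor (arrow p q) (arrow q p)

open Classical in
/-- `sgn p q = -1` if `p = q` or there is an arrow from `p` to `q`, and `1` otherwise. -/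
def sgn {P : Type*} (arrow : P → P → Prop) (p q : P) : ℤˣ :=
  if p = q ∨ arrow p q then -1 else 1

/-! ### Heaps -/

/-- Labelled heaps over the Dynkin diagram of `A` (local finiteness is `LocallyFiniteOrder`). Two
labels are concurrent when they are equal or adjacent. -/
structure LabelledHeap {P : Type*} (A : Matrix P P ℤ) (E : Type*) [PartialOrder E]
    [LocallyFiniteOrder E] where
  label : E → P
  comparable : ∀ a b, (label a = label b ∨ (dynkinGraph A).Adj (label a) (label b)) →
    a ≤ b ∨ b ≤ a
  le_iff_transGen : ∀ a b, a ≤ b ↔ Relation.TransGen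
    (fun x y => x ≤ y ∧ (label x = label y ∨ (dynkinGraph A).Adj (label x) (label y))) a b

/-- Fibred heaps. The first three fields say that each fibre of the labelling is a nonempty poset
that is unbounded above and below. -/
structure FibredHeap {P : Type*} (A : Matrix P P ℤ) (E : Type*) [PartialOrder E]
    [LocallyFiniteOrder E] extends LabelledHeap A E where
  exists_label : ∀ p, ∃ a, label a = p
  exists_gt : ∀ a, ∃ b, label b = label a ∧ a < b
  exists_lt : ∀ a, ∃ b, label b = label a ∧ b < a
  exists_covBy : ∀ p p', (dynkinGraph A).Adj p p' → ∀ a, label a = p →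
    ∃ b, label b = p' ∧ (b ⋖ a ∨ a ⋖ b)

/-- Full heaps. -/
structure FullHeap {P : Type*} (A : Matrix P P ℤ) (E : Type*) [PartialOrder E]
    [LocallyFiniteOrder E] extends FibredHeap A E where
  full : ∀ a b, a < b → label a = label b → (∀ c ∈ Finset.Ioo a b, label c ≠ label a) →
    ∑ c ∈ Finset.Ioo a b, A (label a) (label c) = -2

section Operators

variable {P : Type*} {A : Matrix P P ℤ} {E : Type*} [PartialOrder E] [LocallyFiniteOrder E]

/-- Proper ideals of a heap: lower sets `I` such that, for each vertex `p`, some but not all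
elements labelled `p` lie in `I` (in particular `I` is neither empty nor everything). -/
def ProperIdeal (H : FullHeap A E) : Type _ :=
  {I : LowerSet E // ∀ p, (∃ a ∈ I, H.label a = p) ∧ (∃ a ∉ I, H.label a = p)}

/-- The underlying set of a proper ideal. -/
def ProperIdeal.carrier {H : FullHeap A E} (I : ProperIdeal H) : Set E := (I.1 : Set E)

/-- `L ≻ I`: the set `I ∪ L` is an ideal and `I ∩ L = ∅`. -/
def Addable {H : FullHeap A E} (L : Finset E) (I : ProperIdeal H) : Prop :=
  IsLowerSet (I.carrier ∪ L) ∧ Disjoint I.carrier (L : Set E)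

/-- `L ≺ I`: the set `L` is contained in `I` and `I \ L` is an ideal. -/
def Removable {H : FullHeap A E} (L : Finset E) (I : ProperIdeal H) : Prop :=
  (L : Set E) ⊆ I.carrier ∧ IsLowerSet (I.carrier \ L)

/-- For a finite set `L` and an element `a` there is a larger element with the same label that is
outside `L`. -/
theorem exists_ge_notMem (H : FullHeap A E) (L : Finset E) (a : E) :
    ∃ b, H.label b = H.label a ∧ a ≤ b ∧ b ∉ L := by
  classical
  by_contra hcon
  push Not at hcon
  have hne : (L.filter fun b => H.label b = H.label a ∧ a ≤ b).Nonempty :=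
    ⟨a, by simp [hcon a rfl le_rfl]⟩
  obtain ⟨m, hm⟩ := Finset.exists_maximal hne
  have hmem := hm.1
  simp only [Finset.mem_filter] at hmem
  obtain ⟨c, hc, hlt⟩ := H.exists_gt m
  have hca : H.label c = H.label a := hc.trans hmem.2.1
  have hac : a ≤ c := hmem.2.2.trans hlt.le
  have : c ∈ L.filter fun b => H.label b = H.label a ∧ a ≤ b := by
    simp [hcon c hca hac, hca, hac]
  exact absurd (hm.2 this hlt.le) (not_le_of_gt hlt)

/-- For a finite set `L` and an element `a` there is a smaller element with the same label that is
outside `L`. -/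
theorem exists_le_notMem (H : FullHeap A E) (L : Finset E) (a : E) :
    ∃ b, H.label b = H.label a ∧ b ≤ a ∧ b ∉ L := by
  classical
  by_contra hcon
  push Not at hcon
  have hne : (L.filter fun b => H.label b = H.label a ∧ b ≤ a).Nonempty :=
    ⟨a, by simp [hcon a rfl le_rfl]⟩
  obtain ⟨m, hm⟩ := Finset.exists_minimal hne
  have hmem := hm.1
  simp only [Finset.mem_filter] at hmem
  obtain ⟨c, hc, hlt⟩ := H.exists_lt m
  have hca : H.label c = H.label a := hc.trans hmem.2.1
  have hac : c ≤ a := hlt.le.trans hmem.2.2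
  have : c ∈ L.filter fun b => H.label b = H.label a ∧ b ≤ a := by
    simp [hcon c hca hac, hca, hac]
  exact absurd (hm.2 this hlt.le) (not_le_of_gt hlt)

/-- The proper ideal `I ∪ L`, for `L ≻ I`. -/
def ProperIdeal.union {H : FullHeap A E} (I : ProperIdeal H) (L : Finset E) (h : Addable L I) :
    ProperIdeal H :=
  ⟨⟨I.carrier ∪ L, h.1⟩, fun p => by
    obtain ⟨⟨a, ha, hap⟩, ⟨b, hb, hbp⟩⟩ := I.2 p
    refine ⟨⟨a, Or.inl ha, hap⟩, ?_⟩
    obtain ⟨c, hc, hbc, hcL⟩ := exists_ge_notMem H L b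
    exact ⟨c, fun hmem => hmem.elim (fun hI => hb (I.1.lower hbc hI))
      (fun hL => hcL (Finset.mem_coe.1 hL)), hc.trans hbp⟩⟩

/-- The proper ideal `I \ L`, for `L ≺ I`. -/
def ProperIdeal.sdiff {H : FullHeap A E} (I : ProperIdeal H) (L : Finset E) (h : Removable L I) :
    ProperIdeal H :=
  ⟨⟨I.carrier \ L, h.2⟩, fun p => by
    obtain ⟨⟨a, ha, hap⟩, ⟨b, hb, hbp⟩⟩ := I.2 p
    refine ⟨?_, ⟨b, fun hmem => hb hmem.1, hbp⟩⟩
    obtain ⟨c, hc, hca, hcL⟩ := exists_le_notMem H L a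
    exact ⟨c, ⟨I.1.lower hca ha, fun hL => hcL (Finset.mem_coe.1 hL)⟩, hc.trans hap⟩⟩

/-- The set `𝓛_χ(E)` of finite convex subheaps of `E` having `χ p` elements labelled `p` for every
vertex `p`. -/
def heapsOfCharacter [DecidableEq P] (H : FullHeap A E) (χ : P → ℕ) : Set (Finset E) :=
  {L | (L : Set E).OrdConnected ∧ ∀ p, (L.filter fun a => H.label a = p).card = χ p}

open Classical in
/-- The parity `∏_{a, b ∈ L, a > b} sgn(label a, label b)` of a finite heap. For a convex subheap
the order of the subheap is the restriction of the order of `E`. -/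
def parity (H : FullHeap A E) (arrow : P → P → Prop) (L : Finset E) : ℤˣ :=
  ∏ x ∈ (L ×ˢ L).filter (fun x => x.2 < x.1), sgn arrow (H.label x.1) (H.label x.2)

variable (k : Type*) [Field k]

/-- The space `V_E` with basis `v_I`, for `I` a proper ideal. -/
abbrev VSpace (H : FullHeap A E) : Type _ := ProperIdeal H →₀ k

/-- The basis vector `v_I`. -/
def basisVec {H : FullHeap A E} (I : ProperIdeal H) : VSpace k H := Finsupp.single I 1

open Classical in
/-- `X_L v_I = v_{I ∪ L}` if `L ≻ I`, and `0` otherwise. -/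
def opX (H : FullHeap A E) (L : Finset E) : Module.End k (VSpace k H) :=
  Finsupp.linearCombination k fun I : ProperIdeal H =>
    if h : Addable L I then basisVec k (I.union L h) else 0

open Classical in
/-- `Y_L v_I = v_{I \ L}` if `L ≺ I`, and `0` otherwise. -/
def opY (H : FullHeap A E) (L : Finset E) : Module.End k (VSpace k H) :=
  Finsupp.linearCombination k fun I : ProperIdeal H =>
    if h : Removable L I then basisVec k (I.sdiff L h) else 0

open Classical in
/-- `H_L v_I` is `v_I` if `L ≺ I` and not `L ≻ I`, is `-v_I` if `L ≻ I` and not `L ≺ I`, and is `0`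
otherwise. -/
def opH (H : FullHeap A E) (L : Finset E) : Module.End k (VSpace k H) :=
  Finsupp.linearCombination k fun I : ProperIdeal H =>
    if Removable L I ∧ ¬ Addable L I then basisVec k I
    else if Addable L I ∧ ¬ Removable L I then -basisVec k I
    else 0

/-- The operator `∑_{L ∈ S} T L`, where the possibly infinite sum is taken on each basis vector
separately. In the uses below at most one summand is nonzero on a given basis vector, because an
ideal and a character determine the subheap of that character which can be added or removed. -/
def pointwiseSum {H : FullHeap A E} (S : Set (Finset E))
    (T : Finset E → Module.End k (VSpace k H)) : Module.End k (VSpace k H) :=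
  Finsupp.linearCombination k fun I : ProperIdeal H =>
    ∑ᶠ (L : Finset E) (_ : L ∈ S), T L (basisVec k I)

variable [DecidableEq P]

/-- `X_p`, the sum of `X_L` over the one-element subheaps labelled `p`. -/
def vertexX (H : FullHeap A E) (p : P) : Module.End k (VSpace k H) :=
  pointwiseSum k (heapsOfCharacter H (Pi.single p 1)) (opX k H)

/-- `Y_p`, the sum of `Y_L` over the one-element subheaps labelled `p`. -/
def vertexY (H : FullHeap A E) (p : P) : Module.End k (VSpace k H) :=
  pointwiseSum k (heapsOfCharacter H (Pi.single p 1)) (opY k H)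

/-- `H_p`, the sum of `H_L` over the one-element subheaps labelled `p`. -/
def vertexH (H : FullHeap A E) (p : P) : Module.End k (VSpace k H) :=
  pointwiseSum k (heapsOfCharacter H (Pi.single p 1)) (opH k H)

/-- `X_χ`, the sum of `sgn(L) X_L` over the subheaps `L` of character `χ`. -/
def charX (H : FullHeap A E) (arrow : P → P → Prop) (χ : P → ℕ) : Module.End k (VSpace k H) :=
  pointwiseSum k (heapsOfCharacter H χ) fun L => (parity H arrow L : ℤ) • opX k H L

/-- `Y_χ`, the sum of `sgn(L) Y_L` over the subheaps `L` of character `χ`. -/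
def charY (H : FullHeap A E) (arrow : P → P → Prop) (χ : P → ℕ) : Module.End k (VSpace k H) :=
  pointwiseSum k (heapsOfCharacter H χ) fun L => (parity H arrow L : ℤ) • opY k H L

/-- `H_χ`, the sum of `H_L` over the subheaps `L` of character `χ`. -/
def charH (H : FullHeap A E) (χ : P → ℕ) : Module.End k (VSpace k H) :=
  pointwiseSum k (heapsOfCharacter H χ) (opH k H)

end Operators

/-! ### Real roots and coroots -/

section Roots

variable {Q : Type*} [Fintype Q] [DecidableEq Q]

/-- `s_i v = v - ⟨v, αᵢ^∨⟩ αᵢ` on coordinates with respect to the simple roots, where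
`⟨αⱼ, αᵢ^∨⟩ = A i j`. -/
def rootReflection (A : Matrix Q Q ℤ) (i : Q) (v : Q → ℤ) : Q → ℤ :=
  v - Pi.single i (A.mulVec v i)

/-- `s_i h = h - ⟨αᵢ, h⟩ αᵢ^∨` on coordinates with respect to the simple coroots. -/
def corootReflection (A : Matrix Q Q ℤ) (i : Q) (h : Q → ℤ) : Q → ℤ :=
  h - Pi.single i (Matrix.vecMul h A i)

/-- Real roots: the vectors `w αᵢ`, with `w` in the Weyl group, given as a word in the simple
reflections. -/
def IsRealRoot (A : Matrix Q Q ℤ) (v : Q → ℤ) : Prop :=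
  ∃ (w : List Q) (i : Q), v = w.foldr (rootReflection A) (Pi.single i 1)

/-- `h` is the dual real root (coroot) `v^∨ = w αᵢ^∨` of the real root `v = w αᵢ`. -/
def IsCorootOf (A : Matrix Q Q ℤ) (v h : Q → ℤ) : Prop :=
  ∃ (w : List Q) (i : Q), v = w.foldr (rootReflection A) (Pi.single i 1) ∧
    h = w.foldr (corootReflection A) (Pi.single i 1)

/-- The set of real roots as a type. In finite type these are all the roots. -/
def RealRoot (A : Matrix Q Q ℤ) : Type _ := {v : Q → ℤ // IsRealRoot A v}

/-- The simple root `αᵢ`. -/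
def simpleRoot (A : Matrix Q Q ℤ) (i : Q) : RealRoot A := ⟨Pi.single i 1, [], i, rfl⟩

theorem rootReflection_neg (A : Matrix Q Q ℤ) (i : Q) (v : Q → ℤ) :
    rootReflection A i (-v) = -rootReflection A i v := by
  ext j
  by_cases h : j = i
  · subst h; simp [rootReflection, Matrix.mulVec_neg]; ring
  · simp [rootReflection, h]

/-- For the matrices considered here (diagonal entries `2`) the negative of a real root is a real
root. -/
theorem IsRealRoot.neg {A : Matrix Q Q ℤ} (hA : IsGeneralizedCartanMatrix A) {v : Q → ℤ}
    (hv : IsRealRoot A v) : IsRealRoot A (-v) := by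
  obtain ⟨w, i, rfl⟩ := hv
  refine ⟨w ++ [i], i, ?_⟩
  have key : rootReflection A i (Pi.single i 1) = -Pi.single i 1 := by
    ext j
    by_cases h : j = i
    · subst h; simp [rootReflection, hA.diag]
    · simp [rootReflection, h]
  rw [List.foldr_append, List.foldr_cons, List.foldr_nil, key]
  induction w with
  | nil => rfl
  | cons a w ih => rw [List.foldr_cons, List.foldr_cons, ← ih, rootReflection_neg]

theorem IsGeneralizedCartanMatrix.deleteVertex {P : Type*} {A : Matrix P P ℤ}
    (hA : IsGeneralizedCartanMatrix A) (o : P) :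
    IsGeneralizedCartanMatrix (deleteVertex A o) :=
  ⟨fun i => hA.diag i, fun i j h => hA.nonpos i j fun h' => h (Subtype.ext h'),
    fun i j => hA.zero_iff i j⟩

/-- The root `-α`. -/
def RealRoot.neg {A : Matrix Q Q ℤ} (hA : IsGeneralizedCartanMatrix A) (α : RealRoot A) :
    RealRoot A := ⟨-α.1, IsRealRoot.neg hA α.2⟩

/-- The bimultiplicative extension `ε(α, β) = ∏ sgn(i, j)^(αᵢ βⱼ)` of `sgn` to integral
combinations of the simple roots. -/
def asymmetry (sg : Q → Q → ℤˣ) (v w : Q → ℤ) : ℤˣ :=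
  ∏ i, ∏ j, sg i j ^ (v i * w j)

/-! ### The simply laced simple Lie algebra in its Chevalley basis -/

/-- The complex vector space `𝔥 ⊕ ⨁_α ℂ E_α`, where `𝔥` has the basis of simple coroots and `α`
runs over all roots. -/
abbrev ChevalleySpace (A : Matrix Q Q ℤ) : Type _ := (Q → ℂ) × (RealRoot A →₀ ℂ)

/-- The simple coroot `αᵢ^∨` as an element of `𝔥`. -/
def coE (A : Matrix Q Q ℤ) (i : Q) : ChevalleySpace A := (Pi.single i 1, 0)

/-- The root vector `E_α`. -/
def rootE {A : Matrix Q Q ℤ} (α : RealRoot A) : ChevalleySpace A := (0, Finsupp.single α 1)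

open Classical in
/-- `[E_α, E_β]`, which is `-α^∨` if `α + β = 0`, is `ε(α, β) E_{α+β}` if `α + β` is a root, and is
`0` otherwise. As `A` is simply laced, `α^∨` has in the simple coroots the coordinates that `α` has
in the simple roots. -/
def rootBracket (A : Matrix Q Q ℤ) (sg : Q → Q → ℤˣ) (α β : RealRoot A) : ChevalleySpace A :=
  if α.1 + β.1 = 0 then (fun i => -(α.1 i : ℂ), 0)
  else if h : IsRealRoot A (α.1 + β.1) then ((asymmetry sg α.1 β.1 : ℤ) : ℂ) • rootE ⟨_, h⟩
  else 0

/-- `⟨β, h⟩`, for a root `β` and an element `h` of `𝔥`. -/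
def rootEval (A : Matrix Q Q ℤ) (β : RealRoot A) (h : Q → ℂ) : ℂ :=
  ∑ i, h i * (A.mulVec β.1 i : ℤ)

/-- The bracket of the Lie algebra, that is, the bilinear map with `[h, h'] = 0`,
`[h, E_β] = -[E_β, h] = ⟨β, h⟩ E_β`, and `[E_α, E_β]` as in `rootBracket`. -/
def chevalleyBracket (A : Matrix Q Q ℤ) (sg : Q → Q → ℤˣ) (x y : ChevalleySpace A) :
    ChevalleySpace A :=
  (y.2.sum fun β c => (c * rootEval A β x.1) • rootE β)
    - (x.2.sum fun α c => (c * rootEval A α y.1) • rootE α)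
    + x.2.sum fun α c => y.2.sum fun β d => (c * d) • rootBracket A sg α β

end Roots

/-- A function on the vertices other than `o`, extended by `0` to all vertices. -/
def extendByZero {P : Type*} [DecidableEq P] (o : P) (α : {p : P // p ≠ o} → ℕ) : P → ℕ :=
  fun p => if h : p = o then 0 else α ⟨p, h⟩

/-- `ψ` is a representation on `V_E` (over the complex numbers) of the simple Lie algebra attached
to the diagram without the vertex `o`, such that the Chevalley generators `hᵢ = αᵢ^∨`,
`eᵢ = E_{αᵢ}` and `fᵢ = -E_{-αᵢ}` act as `H_i`, `X_i` and `Y_i`. -/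
structure IsGeneratorRep {P : Type*} [Fintype P] [DecidableEq P] {A : Matrix P P ℤ}
    (hA : IsGeneralizedCartanMatrix A) {E : Type*} [PartialOrder E] [LocallyFiniteOrder E]
    (H : FullHeap A E) (arrow : P → P → Prop) (o : P)
    (ψ : ChevalleySpace (deleteVertex A o) →ₗ[ℂ] Module.End ℂ (VSpace ℂ H)) : Prop where
  map_bracket : ∀ x y,
    ψ (chevalleyBracket (deleteVertex A o) (fun i j => sgn arrow i.1 j.1) x y) = ⁅ψ x, ψ y⁆
  map_h : ∀ i, ψ (coE _ i) = vertexH ℂ H i.1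
  map_e : ∀ i, ψ (rootE (simpleRoot _ i)) = vertexX ℂ H i.1
  map_f : ∀ i, ψ (-rootE ((simpleRoot _ i).neg (hA.deleteVertex o))) = vertexY ℂ H i.1

end FullHeapRep

end

noncomputable section

namespace FullHeapRep

section Heights

variable {P : Type*} {A : Matrix P P ℤ} {E : Type*} [PartialOrder E] [LocallyFiniteOrder E]

/-- The elements of a heap with a given label form a chain isomorphic to `ℤ`. -/
theorem FullHeap.exists_enumeration (H : FullHeap A E) (p : P) :
    ∃ e : ℤ → E, StrictMono e ∧ ∀ x, H.label x = p ↔ ∃ n, e n = x := by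
  classical
  let F := {x : E // H.label x = p}
  let _ : LinearOrder F :=
    { (inferInstance : PartialOrder F) with
      le_total := fun a b => H.comparable a.1 b.1 (Or.inl (a.2.trans b.2.symm))
      toDecidableLE := Classical.decRel _ }
  let _ : LocallyFiniteOrder F := Subtype.instLocallyFiniteOrder (fun x : E => H.label x = p)
  let _ : SuccOrder F := LinearLocallyFiniteOrder.succOrder F
  let _ : PredOrder F := LinearLocallyFiniteOrder.predOrder F
  have : NoMaxOrder F := ⟨fun a => by
    obtain ⟨b, hb, hab⟩ := H.exists_gt a.1
    exact ⟨⟨b, hb.trans a.2⟩, hab⟩⟩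
  have : NoMinOrder F := ⟨fun a => by
    obtain ⟨b, hb, hab⟩ := H.exists_lt a.1
    exact ⟨⟨b, hb.trans a.2⟩, hab⟩⟩
  have : Nonempty F := by
    obtain ⟨a, ha⟩ := H.exists_label p
    exact ⟨⟨a, ha⟩⟩
  let f : F ≃o ℤ := orderIsoIntOfLinearSuccPredArch
  refine ⟨fun n => (f.symm n).1, fun m n h => ?_, fun x => ⟨fun hx => ⟨f ⟨x, hx⟩, by simp⟩, ?_⟩⟩
  · exact (f.symm.strictMono h : f.symm m < f.symm n)
  · rintro ⟨n, rfl⟩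
    exact (f.symm n).2

/-- The `n`-th element labelled `p`. -/
def FullHeap.el (H : FullHeap A E) (p : P) (n : ℤ) : E := (H.exists_enumeration p).choose n

theorem FullHeap.el_strictMono (H : FullHeap A E) (p : P) : StrictMono (H.el p) :=
  (H.exists_enumeration p).choose_spec.1

@[simp] theorem FullHeap.label_el (H : FullHeap A E) (p : P) (n : ℤ) : H.label (H.el p n) = p :=
  ((H.exists_enumeration p).choose_spec.2 _).2 ⟨n, rfl⟩

theorem FullHeap.exists_el (H : FullHeap A E) (x : E) : ∃ n, H.el (H.label x) n = x :=
  ((H.exists_enumeration (H.label x)).choose_spec.2 x).1 rfl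

variable {H : FullHeap A E}

theorem ProperIdeal.exists_height (I : ProperIdeal H) (p : P) :
    ∃ m : ℤ, ∀ n, H.el p n ∈ I.carrier ↔ n ≤ m := by
  obtain ⟨⟨a, ha, hap⟩, ⟨b, hb, hbp⟩⟩ := I.2 p
  obtain ⟨n, hn⟩ := H.exists_el a
  obtain ⟨m, hm⟩ := H.exists_el b
  rw [hap] at hn
  rw [hbp] at hm
  subst hn hm
  obtain ⟨l, hl, hl'⟩ := Int.exists_greatest_of_bdd (P := fun n => H.el p n ∈ I.carrier)
    ⟨m, fun z hz => by
      by_contra! hzm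
      exact hb (I.1.lower ((H.el_strictMono p).monotone hzm.le) hz)⟩ ⟨n, ha⟩
  exact ⟨l, fun z => ⟨fun hz => hl' z hz, fun hz =>
    I.1.lower ((H.el_strictMono p).monotone hz) hl⟩⟩

/-- The index of the largest element labelled `p` of a proper ideal. -/
def ProperIdeal.height (I : ProperIdeal H) (p : P) : ℤ := (I.exists_height p).choose

theorem ProperIdeal.el_mem (I : ProperIdeal H) (p : P) (n : ℤ) :
    H.el p n ∈ I.carrier ↔ n ≤ I.height p := (I.exists_height p).choose_spec n

theorem ProperIdeal.carrier_subset_iff {I J : ProperIdeal H} :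
    I.carrier ⊆ J.carrier ↔ I.height ≤ J.height := by
  constructor
  · intro h p
    exact (J.el_mem p _).1 (h ((I.el_mem p _).2 le_rfl))
  · intro h x hx
    obtain ⟨n, hn⟩ := H.exists_el x
    rw [← hn] at hx ⊢
    exact (J.el_mem _ _).2 (((I.el_mem _ _).1 hx).trans (h _))

theorem ProperIdeal.height_injective :
    Function.Injective (ProperIdeal.height : ProperIdeal H → P → ℤ) := by
  intro I J h
  apply Subtype.ext
  apply SetLike.coe_injective
  exact (ProperIdeal.carrier_subset_iff.2 h.le).antisymm (ProperIdeal.carrier_subset_iff.2 h.ge)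

theorem ProperIdeal.lower (I : ProperIdeal H) {x y : E} (h : x ≤ y) (hy : y ∈ I.carrier) :
    x ∈ I.carrier := I.1.lower h hy

/-- Two labels are concurrent when they are equal or adjacent. -/
def Concurrent (A : Matrix P P ℤ) (p q : P) : Prop := p = q ∨ (dynkinGraph A).Adj p q

theorem FullHeap.exists_concurrent_below (H : FullHeap A E) {x b : E} (h : x < b) :
    ∃ y, x ≤ y ∧ y < b ∧ Concurrent A (H.label y) (H.label b) := by
  have key : ∀ c, Relation.TransGen (fun x y => x ≤ y ∧
      (H.label x = H.label y ∨ (dynkinGraph A).Adj (H.label x) (H.label y))) x c →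
      x = c ∨ ∃ y, x ≤ y ∧ y < c ∧ Concurrent A (H.label y) (H.label c) := by
    intro c hc
    induction hc with
    | @single c hc =>
      rcases hc.1.eq_or_lt with h | h
      · exact Or.inl h
      · exact Or.inr ⟨x, le_rfl, h, hc.2⟩
    | @tail c d hc hd ih =>
      rcases hd.1.eq_or_lt with h | h
      · subst h
        exact ih
      · exact Or.inr ⟨c, (H.le_iff_transGen _ _).2 hc, h, hd.2⟩
  exact (key b ((H.le_iff_transGen _ _).1 h.le)).resolve_left h.ne

theorem FullHeap.exists_concurrent_above (H : FullHeap A E) {x a : E} (h : a < x) :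
    ∃ y, y ≤ x ∧ a < y ∧ Concurrent A (H.label y) (H.label a) := by
  have key : ∀ c, Relation.TransGen (fun x y => x ≤ y ∧
      (H.label x = H.label y ∨ (dynkinGraph A).Adj (H.label x) (H.label y))) c x →
      x = c ∨ ∃ y, y ≤ x ∧ c < y ∧ Concurrent A (H.label y) (H.label c) := by
    intro c hc
    induction hc using Relation.TransGen.head_induction_on with
    | @single c hc =>
      rcases hc.1.eq_or_lt with h | h
      · exact Or.inl h.symm
      · exact Or.inr ⟨x, le_rfl, h, hc.2.imp Eq.symm SimpleGraph.Adj.symm⟩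
    | @head c d hd hc ih =>
      rcases hd.1.eq_or_lt with h | h
      · subst h
        exact ih
      · exact Or.inr ⟨d, (H.le_iff_transGen _ _).2 hc, h, hd.2.imp Eq.symm SimpleGraph.Adj.symm⟩
  exact (key a ((H.le_iff_transGen _ _).1 h.le)).resolve_left h.ne'

theorem ProperIdeal.height_union [DecidableEq P] {I : ProperIdeal H} {L : Finset E} (h : Addable L I) (p : P) :
    ((L.filter fun a => H.label a = p).card : ℤ) = (I.union L h).height p - I.height p := by
  classical
  have hle : I.height p ≤ (I.union L h).height p :=
    (ProperIdeal.carrier_subset_iff (J := I.union L h)).1 (fun x hx => Or.inl hx) p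
  have : L.filter (fun a => H.label a = p) =
      (Finset.Ioc (I.height p) ((I.union L h).height p)).map
        ⟨H.el p, (H.el_strictMono p).injective⟩ := by
    ext x
    simp only [Finset.mem_filter, Finset.mem_map, Finset.mem_Ioc, Function.Embedding.coeFn_mk]
    constructor
    · rintro ⟨hx, rfl⟩
      obtain ⟨n, hn⟩ := H.exists_el x
      refine ⟨n, ⟨?_, ?_⟩, hn⟩
      · by_contra! hlt
        have := (I.el_mem _ _).2 hlt
        rw [hn] at this
        exact Set.disjoint_left.1 h.2 this hx
      · rw [← ProperIdeal.el_mem, hn]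
        exact Or.inr hx
    · rintro ⟨n, ⟨h1, h2⟩, rfl⟩
      refine ⟨?_, H.label_el _ _⟩
      rw [← ProperIdeal.el_mem] at h2
      rcases h2 with h2 | h2
      · exact absurd ((I.el_mem _ _).1 h2) (not_le.2 h1)
      · exact h2
  rw [this, Finset.card_map, Int.card_Ioc]
  exact Int.toNat_of_nonneg (by linarith)

theorem ProperIdeal.height_sdiff [DecidableEq P] {I : ProperIdeal H} {L : Finset E} (h : Removable L I) (p : P) :
    ((L.filter fun a => H.label a = p).card : ℤ) = I.height p - (I.sdiff L h).height p := by
  have hset : (I.sdiff L h).carrier ∪ L = I.carrier := Set.sdiff_union_of_subset h.1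
  have hadd : Addable L (I.sdiff L h) :=
    ⟨by rw [hset]; exact I.1.lower', Set.disjoint_sdiff_left⟩
  have : (I.sdiff L h).union L hadd = I := by
    apply Subtype.ext
    apply SetLike.coe_injective
    exact hset
  rw [ProperIdeal.height_union hadd p, this]

theorem Addable.height_union_eq [DecidableEq P] {I : ProperIdeal H} {L : Finset E}
    (h : Addable L I) {χ : P → ℕ} (hL : L ∈ heapsOfCharacter H χ) :
    (I.union L h).height = I.height + fun p => (χ p : ℤ) := by
  ext p
  have := ProperIdeal.height_union h p
  rw [hL.2 p] at this
  simp only [Pi.add_apply]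
  linarith

theorem Removable.height_sdiff_eq [DecidableEq P] {I : ProperIdeal H} {L : Finset E}
    (h : Removable L I) {χ : P → ℕ} (hL : L ∈ heapsOfCharacter H χ) :
    (I.sdiff L h).height = I.height - fun p => (χ p : ℤ) := by
  ext p
  have := ProperIdeal.height_sdiff h p
  rw [hL.2 p] at this
  simp only [Pi.sub_apply]
  linarith

/-- The intersection of two proper ideals. -/
def ProperIdeal.inf (I J : ProperIdeal H) : ProperIdeal H :=
  ⟨⟨I.carrier ∩ J.carrier, I.1.lower'.inter J.1.lower'⟩, fun p =>
    ⟨⟨H.el p (min (I.height p) (J.height p)), ⟨(I.el_mem _ _).2 (min_le_left _ _),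
      (J.el_mem _ _).2 (min_le_right _ _)⟩, H.label_el _ _⟩,
    ⟨H.el p (I.height p + 1), fun h => absurd ((I.el_mem _ _).1 h.1) (by simp),
      H.label_el _ _⟩⟩⟩

theorem ProperIdeal.height_inf (I J : ProperIdeal H) :
    (I.inf J).height = I.height ⊓ J.height := by
  ext p
  apply eq_of_forall_le_iff
  intro n
  rw [← ProperIdeal.el_mem, Pi.inf_apply, le_inf_iff, ← ProperIdeal.el_mem, ← ProperIdeal.el_mem]
  rfl

/-- The difference `J \ I` of two proper ideals, as a finite set. -/
def idealDiff [Fintype P] (I J : ProperIdeal H) : Finset E :=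
  open Classical in
  Finset.univ.biUnion fun p => (Finset.Ioc (I.height p) (J.height p)).image (H.el p)

theorem mem_idealDiff [Fintype P] {I J : ProperIdeal H} {x : E} :
    x ∈ idealDiff I J ↔ x ∈ J.carrier ∧ x ∉ I.carrier := by
  classical
  simp only [idealDiff, Finset.mem_biUnion, Finset.mem_univ, true_and, Finset.mem_image,
    Finset.mem_Ioc]
  constructor
  · rintro ⟨p, n, ⟨h1, h2⟩, rfl⟩
    rw [ProperIdeal.el_mem, ProperIdeal.el_mem]
    exact ⟨h2, not_le.2 h1⟩
  · rintro ⟨h1, h2⟩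
    obtain ⟨n, hn⟩ := H.exists_el x
    rw [← hn, ProperIdeal.el_mem] at h1 h2
    exact ⟨_, n, ⟨not_le.1 h2, h1⟩, hn⟩

variable [Fintype P]

theorem coe_idealDiff (I J : ProperIdeal H) :
    (idealDiff I J : Set E) = J.carrier \ I.carrier := by
  ext x
  simp [mem_idealDiff]

theorem addable_idealDiff {I J : ProperIdeal H} (h : I.height ≤ J.height) :
    Addable (idealDiff I J) I := by
  rw [Addable, coe_idealDiff, Set.union_sdiff_cancel (ProperIdeal.carrier_subset_iff.2 h)]
  exact ⟨J.1.lower', Set.disjoint_sdiff_right⟩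

theorem removable_idealDiff {I J : ProperIdeal H} (h : J.height ≤ I.height) :
    Removable (idealDiff J I) I := by
  rw [Removable, coe_idealDiff, Set.sdiff_sdiff_right_self,
    Set.inter_eq_self_of_subset_right (ProperIdeal.carrier_subset_iff.2 h)]
  exact ⟨Set.sdiff_subset, J.1.lower'⟩

theorem union_idealDiff {I J : ProperIdeal H} (h : I.height ≤ J.height) :
    I.union (idealDiff I J) (addable_idealDiff h) = J := by
  apply Subtype.ext
  apply SetLike.coe_injective
  change I.carrier ∪ (idealDiff I J : Set E) = J.carrier
  rw [coe_idealDiff, Set.union_sdiff_cancel (ProperIdeal.carrier_subset_iff.2 h)]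

theorem sdiff_idealDiff {I J : ProperIdeal H} (h : J.height ≤ I.height) :
    I.sdiff (idealDiff J I) (removable_idealDiff h) = J := by
  apply Subtype.ext
  apply SetLike.coe_injective
  change I.carrier \ (idealDiff J I : Set E) = J.carrier
  rw [coe_idealDiff, Set.sdiff_sdiff_right_self,
    Set.inter_eq_self_of_subset_right (ProperIdeal.carrier_subset_iff.2 h)]

theorem Addable.eq_idealDiff {I : ProperIdeal H} {L : Finset E} (h : Addable L I) :
    L = idealDiff I (I.union L h) := by
  apply Finset.coe_injective
  rw [coe_idealDiff]
  change (L : Set E) = (I.carrier ∪ L) \ I.carrier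
  rw [Set.union_sdiff_cancel_left (Set.disjoint_iff.1 h.2)]

theorem Removable.eq_idealDiff {I : ProperIdeal H} {L : Finset E} (h : Removable L I) :
    L = idealDiff (I.sdiff L h) I := by
  apply Finset.coe_injective
  rw [coe_idealDiff]
  change (L : Set E) = I.carrier \ (I.carrier \ L)
  rw [Set.sdiff_sdiff_right_self, Set.inter_eq_self_of_subset_right h.1]

theorem ordConnected_idealDiff (I J : ProperIdeal H) : (idealDiff I J : Set E).OrdConnected := by
  rw [coe_idealDiff]
  refine ⟨fun x hx y hy z hz => ⟨J.lower hz.2 hy.1, fun h => hx.2 (I.lower hz.1 h)⟩⟩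

theorem card_filter_idealDiff [DecidableEq P] {I J : ProperIdeal H} (h : I.height ≤ J.height)
    (p : P) :
    (((idealDiff I J).filter fun a => H.label a = p).card : ℤ) = J.height p - I.height p := by
  have := ProperIdeal.height_union (addable_idealDiff h) p
  rw [union_idealDiff h] at this
  rw [← this]

theorem idealDiff_mem_heapsOfCharacter [DecidableEq P] {I J : ProperIdeal H} {χ : P → ℕ}
    (h : J.height = I.height + fun p => (χ p : ℤ)) : idealDiff I J ∈ heapsOfCharacter H χ := by
  refine ⟨ordConnected_idealDiff I J, fun p => ?_⟩
  have hle : I.height ≤ J.height := by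
    rw [h]; intro p; simp
  have := card_filter_idealDiff hle p
  rw [h] at this
  simpa using this

end Heights

section Weights

variable {P : Type*} {A : Matrix P P ℤ} {E : Type*} [PartialOrder E]
  [LocallyFiniteOrder E] {H : FullHeap A E}

open Classical in
/-- The weight of a proper ideal: the eigenvalue of `H_p` on `v_I`, computed from the number of
elements of `I` between the last element labelled `p` in `I` and the next element labelled `p`. -/
def ProperIdeal.weight (I : ProperIdeal H) (p : P) : ℤ :=
  1 + ∑ z ∈ (Finset.Ioo (H.el p (I.height p)) (H.el p (I.height p + 1))).filter
    (fun z => z ∈ I.carrier), A p (H.label z)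

theorem FullHeap.label_ne_of_mem_Ioo {p : P} {n : ℤ} {z : E}
    (hz : z ∈ Finset.Ioo (H.el p n) (H.el p (n + 1))) : H.label z ≠ p := by
  rintro rfl
  obtain ⟨m, hm⟩ := H.exists_el z
  rw [Finset.mem_Ioo] at hz
  rw [← hm, H.label_el] at hz
  have h1 := (H.el_strictMono _).lt_iff_lt.1 hz.1
  have h2 := (H.el_strictMono _).lt_iff_lt.1 hz.2
  omega

theorem adj_iff (hA : IsGeneralizedCartanMatrix A) (p q : P) :
    (dynkinGraph A).Adj p q ↔ p ≠ q ∧ A p q ≠ 0 := by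
  refine ⟨fun h => ⟨h.1, fun h0 => ?_⟩, fun h => ⟨h.1, Or.inl h.2⟩⟩
  rcases h.2 with h2 | h2
  · exact h2 h0
  · exact h2 ((hA.zero_iff _ _).1 h0)

theorem FullHeap.sum_Ioo (H : FullHeap A E) (p : P) (n : ℤ) :
    ∑ z ∈ Finset.Ioo (H.el p n) (H.el p (n + 1)), A p (H.label z) = -2 := by
  have := H.full (H.el p n) (H.el p (n + 1)) (H.el_strictMono p (by omega)) (by simp)
    (fun c hc => by simpa using H.label_ne_of_mem_Ioo hc)
  simpa using this

theorem FullHeap.apply_nonpos_of_mem_Ioo (hA : IsGeneralizedCartanMatrix A) {p : P} {n : ℤ}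
    {z : E} (hz : z ∈ Finset.Ioo (H.el p n) (H.el p (n + 1))) : A p (H.label z) ≤ 0 :=
  hA.nonpos _ _ (H.label_ne_of_mem_Ioo hz).symm

theorem ProperIdeal.weight_mem (hA : IsGeneralizedCartanMatrix A) (I : ProperIdeal H) (p : P) :
    -1 ≤ I.weight p ∧ I.weight p ≤ 1 := by
  classical
  rw [ProperIdeal.weight]
  have h1 := H.sum_Ioo p (I.height p)
  rw [← Finset.sum_filter_add_sum_filter_not _ (fun z => z ∈ I.carrier)] at h1
  have h2 := Finset.sum_nonpos (s := (Finset.Ioo (H.el p (I.height p))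
    (H.el p (I.height p + 1))).filter (fun z => z ∈ I.carrier)) (f := fun z => A p (H.label z))
    (fun z hz => FullHeap.apply_nonpos_of_mem_Ioo hA (Finset.mem_filter.1 hz).1)
  have h3 := Finset.sum_nonpos (s := (Finset.Ioo (H.el p (I.height p))
    (H.el p (I.height p + 1))).filter (fun z => z ∉ I.carrier)) (f := fun z => A p (H.label z))
    (fun z hz => FullHeap.apply_nonpos_of_mem_Ioo hA (Finset.mem_filter.1 hz).1)
  constructor <;> linarith

variable [DecidableEq P]

theorem singleton_mem_heapsOfCharacter (p : P) (n : ℤ) :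
    {H.el p n} ∈ heapsOfCharacter H (Pi.single p 1) := by
  refine ⟨by simpa using Set.ordConnected_singleton, fun q => ?_⟩
  rw [Finset.filter_singleton]
  by_cases h : q = p
  · subst h; simp
  · simp [h, Ne.symm h]

theorem natCast_single (p : P) :
    (fun q => ((Pi.single p 1 : P → ℕ) q : ℤ)) = Pi.single p 1 := by
  ext q
  by_cases h : q = p
  · subst h; simp
  · simp [h]

theorem ProperIdeal.exists_add_single (hA : IsGeneralizedCartanMatrix A) (I : ProperIdeal H)
    {p : P} (h : I.weight p = -1) : ∃ J : ProperIdeal H, J.height = I.height + Pi.single p 1 := by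
  classical
  have hz : ∀ z ∈ Finset.Ioo (H.el p (I.height p)) (H.el p (I.height p + 1)),
      z ∉ I.carrier → A p (H.label z) = 0 := by
    have h1 := H.sum_Ioo p (I.height p)
    rw [← Finset.sum_filter_add_sum_filter_not _ (fun z => z ∈ I.carrier)] at h1
    rw [ProperIdeal.weight] at h
    have h3 := (Finset.sum_eq_zero_iff_of_nonpos (s := (Finset.Ioo (H.el p (I.height p))
      (H.el p (I.height p + 1))).filter (fun z => z ∉ I.carrier)) (f := fun z => A p (H.label z))
      (fun z hz => FullHeap.apply_nonpos_of_mem_Ioo hA (Finset.mem_filter.1 hz).1)).1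
      (by linarith)
    exact fun z hz hzI => h3 z (Finset.mem_filter.2 ⟨hz, hzI⟩)
  have hlow : ∀ x, x < H.el p (I.height p + 1) → x ∈ I.carrier := by
    intro x hx
    obtain ⟨y, hxy, hyb, hc⟩ := H.exists_concurrent_below hx
    refine I.lower hxy ?_
    obtain ⟨n, hn⟩ := H.exists_el y
    rw [H.label_el] at hc
    rcases hc with hc | hc
    · rw [hc] at hn
      rw [← hn] at hyb ⊢
      rw [ProperIdeal.el_mem]
      have := (H.el_strictMono p).lt_iff_lt.1 hyb
      omega
    · by_contra hyI
      rcases H.comparable y (H.el p (I.height p)) (Or.inr (by simpa using hc)) with h1 | h1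
      · exact hyI (I.lower h1 ((I.el_mem _ _).2 le_rfl))
      · have hne : H.el p (I.height p) ≠ y := by
          rintro rfl
          exact hc.1 (H.label_el _ _)
        exact ((adj_iff hA _ _).1 hc.symm).2
          (hz y (Finset.mem_Ioo.2 ⟨lt_of_le_of_ne h1 hne, hyb⟩) hyI)
  have hadd : Addable {H.el p (I.height p + 1)} I := by
    refine ⟨?_, ?_⟩
    · rintro x y hyx (hx | hx)
      · exact Or.inl (I.lower hyx hx)
      · simp only [Finset.coe_singleton, Set.mem_singleton_iff] at hx
        subst hx
        rcases hyx.eq_or_lt with h | h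
        · exact Or.inr (by simpa using h)
        · exact Or.inl (hlow _ h)
    · rw [Finset.coe_singleton, Set.disjoint_singleton_right, ProperIdeal.el_mem]
      omega
  exact ⟨I.union _ hadd, by
    rw [hadd.height_union_eq (singleton_mem_heapsOfCharacter p _), natCast_single]⟩

theorem ProperIdeal.exists_sub_single (hA : IsGeneralizedCartanMatrix A) (I : ProperIdeal H)
    {p : P} (h : I.weight p = 1) : ∃ J : ProperIdeal H, J.height = I.height - Pi.single p 1 := by
  classical
  have hz : ∀ z ∈ Finset.Ioo (H.el p (I.height p)) (H.el p (I.height p + 1)),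
      z ∈ I.carrier → A p (H.label z) = 0 := by
    rw [ProperIdeal.weight] at h
    have h3 := (Finset.sum_eq_zero_iff_of_nonpos (s := (Finset.Ioo (H.el p (I.height p))
      (H.el p (I.height p + 1))).filter (fun z => z ∈ I.carrier)) (f := fun z => A p (H.label z))
      (fun z hz => FullHeap.apply_nonpos_of_mem_Ioo hA (Finset.mem_filter.1 hz).1)).1
      (by linarith)
    exact fun z hz hzI => h3 z (Finset.mem_filter.2 ⟨hz, hzI⟩)
  have hup : ∀ x, H.el p (I.height p) < x → x ∉ I.carrier := by
    intro x hx hxI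
    obtain ⟨y, hxy, hyb, hc⟩ := H.exists_concurrent_above hx
    have hyI := I.lower hxy hxI
    obtain ⟨n, hn⟩ := H.exists_el y
    rw [H.label_el] at hc
    rcases hc with hc | hc
    · rw [hc] at hn
      rw [← hn] at hyb hyI
      rw [ProperIdeal.el_mem] at hyI
      have := (H.el_strictMono p).lt_iff_lt.1 hyb
      omega
    · rcases H.comparable y (H.el p (I.height p + 1)) (Or.inr (by simpa using hc)) with h1 | h1
      · have hne : y ≠ H.el p (I.height p + 1) := by
          rintro rfl
          exact hc.1 (H.label_el _ _)
        exact ((adj_iff hA _ _).1 hc.symm).2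
          (hz y (Finset.mem_Ioo.2 ⟨hyb, lt_of_le_of_ne h1 hne⟩) hyI)
      · have := (I.el_mem _ _).1 (I.lower h1 hyI)
        omega
  have hrem : Removable {H.el p (I.height p)} I := by
    refine ⟨?_, ?_⟩
    · rw [Finset.coe_singleton, Set.singleton_subset_iff, ProperIdeal.el_mem]
    · rintro x y hyx ⟨hx, hx'⟩
      refine ⟨I.lower hyx hx, fun hy => ?_⟩
      simp only [Finset.coe_singleton, Set.mem_singleton_iff] at hy hx'
      subst hy
      exact hup x (lt_of_le_of_ne hyx (Ne.symm hx')) hx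
  exact ⟨I.sdiff _ hrem, by
    rw [hrem.height_sdiff_eq (singleton_mem_heapsOfCharacter p _), natCast_single]⟩

theorem mem_of_height_eq_add_single {I J : ProperIdeal H} {q : P}
    (h : J.height = I.height + Pi.single q 1) {x : E} :
    x ∈ J.carrier ↔ x ∈ I.carrier ∨ x = H.el q (I.height q + 1) := by
  obtain ⟨n, hn⟩ := H.exists_el x
  by_cases hx : H.label x = q
  · rw [hx] at hn
    subst hn
    rw [ProperIdeal.el_mem, ProperIdeal.el_mem, h, (H.el_strictMono q).injective.eq_iff]
    simp only [Pi.add_apply, Pi.single_eq_same]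
    omega
  · have hne : x ≠ H.el q (I.height q + 1) := by
      rintro rfl
      exact hx (H.label_el _ _)
    rw [← hn, ProperIdeal.el_mem, ProperIdeal.el_mem, h, hn]
    simp [hx, hne]

theorem weight_of_height_eq_add_single (hA : IsGeneralizedCartanMatrix A)
    {I J : ProperIdeal H} {q : P} (h : J.height = I.height + Pi.single q 1) (p : P) :
    J.weight p = I.weight p + A p q := by
  classical
  set z := H.el q (I.height q + 1) with hzdef
  have hzI : z ∉ I.carrier := by rw [ProperIdeal.el_mem]; omega
  have hzJ : z ∈ J.carrier := (mem_of_height_eq_add_single h).2 (Or.inr rfl)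
  by_cases hpq : p = q
  · subst hpq
    have h1 : I.weight p = -1 := by
      rw [ProperIdeal.weight, Finset.filter_true_of_mem, H.sum_Ioo]
      · norm_num
      · intro x hx
        rw [Finset.mem_Ioo] at hx
        rcases (mem_of_height_eq_add_single h).1 (J.lower hx.2.le hzJ) with h1 | h1
        · exact h1
        · exact absurd h1 hx.2.ne
    have h2 : J.weight p = 1 := by
      have hJp : J.height p = I.height p + 1 := by rw [h]; simp
      rw [ProperIdeal.weight, Finset.filter_false_of_mem, Finset.sum_empty, add_zero]
      intro x hx hxJ
      rw [hJp, Finset.mem_Ioo] at hx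
      rcases (mem_of_height_eq_add_single h).1 hxJ with h1 | h1
      · exact hzI (I.lower hx.1.le h1)
      · exact hx.1.ne h1.symm
    rw [h1, h2, hA.diag]
    norm_num
  · have hJp : J.height p = I.height p := by rw [h]; simp [hpq]
    rw [ProperIdeal.weight, ProperIdeal.weight, hJp, add_assoc]
    congr 1
    have hzl : H.label z = q := H.label_el _ _
    by_cases hz : z ∈ Finset.Ioo (H.el p (I.height p)) (H.el p (I.height p + 1))
    · have : (Finset.Ioo (H.el p (I.height p)) (H.el p (I.height p + 1))).filter
          (fun z => z ∈ J.carrier) = insert z ((Finset.Ioo (H.el p (I.height p))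
          (H.el p (I.height p + 1))).filter (fun z => z ∈ I.carrier)) := by
        ext x
        simp only [Finset.mem_filter, Finset.mem_insert, mem_of_height_eq_add_single h]
        constructor
        · rintro ⟨h1, h2 | h2⟩
          · exact Or.inr ⟨h1, h2⟩
          · exact Or.inl h2
        · rintro (rfl | h1)
          · exact ⟨hz, Or.inr rfl⟩
          · exact ⟨h1.1, Or.inl h1.2⟩
      rw [this, Finset.sum_insert (by simp [hzI]), hzl, add_comm]
    · have h0 : A p q = 0 := by
        by_contra h0
        have hadj : (dynkinGraph A).Adj p q := ⟨hpq, Or.inl h0⟩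
        refine hz (Finset.mem_Ioo.2 ⟨?_, ?_⟩)
        · rcases H.comparable (H.el p (I.height p)) z (Or.inr (by simpa [hzl] using hadj)) with
            h1 | h1
          · refine lt_of_le_of_ne h1 fun heq => hpq ?_
            rw [← hzl, ← heq, H.label_el]
          · exact absurd (I.lower h1 ((I.el_mem _ _).2 le_rfl)) hzI
        · rcases H.comparable z (H.el p (I.height p + 1)) (Or.inr (by
            simpa [hzl] using hadj.symm)) with h1 | h1
          · refine lt_of_le_of_ne h1 fun heq => hpq ?_
            rw [← hzl, heq, H.label_el]
          · have := (J.el_mem _ _).1 (J.lower h1 hzJ)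
            omega
      rw [h0, add_zero]
      congr 1
      ext x
      simp only [Finset.mem_filter, mem_of_height_eq_add_single h]
      refine and_congr_right fun hx => or_iff_left ?_
      rintro rfl
      exact hz hx

variable [Fintype P]

theorem exists_height_le_of_lt {I J : ProperIdeal H} (hle : I.height ≤ J.height)
    (hne : I.height ≠ J.height) :
    ∃ (K : ProperIdeal H) (q : P), K.height = I.height + Pi.single q 1 ∧ K.height ≤ J.height := by
  have hne' : (idealDiff I J).Nonempty := by
    by_contra hcon
    rw [Finset.not_nonempty_iff_eq_empty] at hcon
    apply hne
    apply le_antisymm hle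
    rw [← ProperIdeal.carrier_subset_iff]
    intro x hx
    by_contra hxI
    have : x ∈ idealDiff I J := mem_idealDiff.2 ⟨hx, hxI⟩
    rw [hcon] at this
    simp at this
  obtain ⟨m, hm⟩ := Finset.exists_minimal hne'
  have hmem := mem_idealDiff.1 hm.1
  have hadd : Addable {m} I := by
    refine ⟨?_, ?_⟩
    · rintro x y hyx (hx | hx)
      · exact Or.inl (I.lower hyx hx)
      · simp only [Finset.coe_singleton, Set.mem_singleton_iff] at hx
        subst hx
        by_cases hy : y ∈ I.carrier
        · exact Or.inl hy
        · have h2 := hm.2 (mem_idealDiff.2 ⟨J.lower hyx hmem.1, hy⟩) hyx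
          exact Or.inr (by simpa using hyx.antisymm h2)
    · rw [Finset.coe_singleton, Set.disjoint_singleton_right]
      exact hmem.2
  obtain ⟨n, hn⟩ := H.exists_el m
  refine ⟨I.union _ hadd, H.label m, ?_, ?_⟩
  · have h1 : ({m} : Finset E) ∈ heapsOfCharacter H (Pi.single (H.label m) 1) := by
      rw [← hn, H.label_el]
      exact singleton_mem_heapsOfCharacter _ _
    rw [hadd.height_union_eq h1, natCast_single]
  · rw [← ProperIdeal.carrier_subset_iff]
    rintro x (hx | hx)
    · exact ProperIdeal.carrier_subset_iff.2 hle hx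
    · simp only [Finset.coe_singleton, Set.mem_singleton_iff] at hx
      subst hx
      exact hmem.1

theorem weight_sub_of_le (hA : IsGeneralizedCartanMatrix A) {I J : ProperIdeal H}
    (hle : I.height ≤ J.height) : J.weight = I.weight + A.mulVec (J.height - I.height) := by
  obtain ⟨n, hn⟩ : ∃ n : ℕ, ∑ p, (J.height p - I.height p) = n :=
    Int.eq_ofNat_of_zero_le (Finset.sum_nonneg fun p _ => sub_nonneg.2 (hle p))
  induction n generalizing I with
  | zero =>
    have : I = J := by
      apply ProperIdeal.height_injective
      ext p
      have := (Finset.sum_eq_zero_iff_of_nonneg (fun p _ => sub_nonneg.2 (hle p))).1 hn p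
        (Finset.mem_univ _)
      linarith
    subst this
    simp
  | succ n ih =>
    have hne : I.height ≠ J.height := by
      intro h
      rw [h] at hn
      simp at hn
      omega
    obtain ⟨K, q, hK, hKJ⟩ := exists_height_le_of_lt hle hne
    have h1 := ih hKJ (by
      rw [hK]
      simp only [Pi.add_apply, Finset.sum_sub_distrib, Finset.sum_add_distrib,
        Fintype.sum_pi_single'] at hn ⊢
      push_cast at hn
      linarith)
    have h2 : K.weight = I.weight + A.mulVec (Pi.single q 1) := by
      ext p
      simp [weight_of_height_eq_add_single hA hK p]
    rw [h1, h2, add_assoc, ← Matrix.mulVec_add, hK]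
    congr 2
    abel

theorem ProperIdeal.weight_eq (hA : IsGeneralizedCartanMatrix A) (I J : ProperIdeal H) :
    J.weight = I.weight + A.mulVec (J.height - I.height) := by
  have h1 := weight_sub_of_le hA (I := I.inf J) (J := I) (by
    rw [ProperIdeal.height_inf]; exact inf_le_left)
  have h2 := weight_sub_of_le hA (I := I.inf J) (J := J) (by
    rw [ProperIdeal.height_inf]; exact inf_le_right)
  rw [h1, h2, add_assoc, ← Matrix.mulVec_add]
  congr 2
  abel

end Weights

open scoped Matrix

section Reflections

variable {Q : Type*} [Fintype Q] {A : Matrix Q Q ℤ}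

theorem isSymm_of_isSimplyLaced {Q : Type*} {A : Matrix Q Q ℤ}
    (hA : IsGeneralizedCartanMatrix A) (hsl : A.IsSimplyLaced) : A.IsSymm := by
  ext i j
  rw [Matrix.transpose_apply]
  by_cases h : i = j
  · rw [h]
  · have h0 := hA.zero_iff i j
    rcases hsl h with h1 | h1 <;> rcases hsl (Ne.symm h) with h2 | h2 <;> simp_all

theorem dotProduct_mulVec_comm (hs : A.IsSymm) (v w : Q → ℤ) :
    v ⬝ᵥ A *ᵥ w = w ⬝ᵥ A *ᵥ v := by
  rw [dotProduct_comm, ← Matrix.vecMul_transpose, hs.eq, Matrix.dotProduct_mulVec]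

variable [DecidableEq Q]

theorem rootReflection_eq (i : Q) (v : Q → ℤ) :
    rootReflection A i v = v - (A *ᵥ v) i • Pi.single i 1 := by
  rw [rootReflection, ← Pi.single_smul]
  simp

theorem rootReflection_add (i : Q) (v w : Q → ℤ) :
    rootReflection A i (v + w) = rootReflection A i v + rootReflection A i w := by
  simp only [rootReflection_eq, Matrix.mulVec_add, Pi.add_apply, add_smul]
  abel

theorem dotProduct_rootReflection (i : Q) (x v : Q → ℤ) :
    x ⬝ᵥ rootReflection A i v = x ⬝ᵥ v - x i * (A *ᵥ v) i := by
  rw [rootReflection_eq, dotProduct_sub, dotProduct_smul, dotProduct_single_one, smul_eq_mul,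
    mul_comm]

theorem rootReflection_involutive (hA : IsGeneralizedCartanMatrix A) (i : Q) (v : Q → ℤ) :
    rootReflection A i (rootReflection A i v) = v := by
  have : (A *ᵥ rootReflection A i v) i = -(A *ᵥ v) i := by
    rw [rootReflection_eq, Matrix.mulVec_sub, Matrix.mulVec_smul, Matrix.mulVec_single_one]
    simp [hA.diag]
    ring
  rw [rootReflection_eq, this, rootReflection_eq]
  module

theorem rootReflection_dotProduct_mulVec (hs : A.IsSymm) (i : Q) (v w : Q → ℤ) :
    rootReflection A i v ⬝ᵥ A *ᵥ w = v ⬝ᵥ A *ᵥ rootReflection A i w := by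
  rw [dotProduct_comm, dotProduct_rootReflection, dotProduct_mulVec_comm hs v,
    rootReflection_eq, sub_dotProduct, smul_dotProduct, single_one_dotProduct,
    dotProduct_comm, smul_eq_mul, mul_comm, dotProduct_mulVec_comm hs w]

theorem IsRealRoot.single (i : Q) : IsRealRoot A (Pi.single i 1) := ⟨[], i, rfl⟩

theorem IsRealRoot.rootReflection (i : Q) {v : Q → ℤ} (hv : IsRealRoot A v) :
    IsRealRoot A (rootReflection A i v) := by
  obtain ⟨w, j, rfl⟩ := hv
  exact ⟨i :: w, j, rfl⟩

@[elab_as_elim]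
theorem IsRealRoot.induction {motive : (v : Q → ℤ) → IsRealRoot A v → Prop}
    (single : ∀ i, motive (Pi.single i 1) (IsRealRoot.single i))
    (reflect : ∀ i v (hv : IsRealRoot A v), motive v hv → motive _ (hv.rootReflection i))
    {v : Q → ℤ} (hv : IsRealRoot A v) : motive v hv := by
  obtain ⟨w, j, rfl⟩ := hv
  induction w with
  | nil => exact single j
  | cons i w ih => exact reflect i _ ⟨w, j, rfl⟩ ih

theorem IsRealRoot.norm_eq_two (hA : IsGeneralizedCartanMatrix A) (hs : A.IsSymm) {v : Q → ℤ}
    (hv : IsRealRoot A v) : v ⬝ᵥ A *ᵥ v = 2 := by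
  induction hv using IsRealRoot.induction with
  | single i => simp [hA.diag]
  | reflect i v hv ih =>
    rw [rootReflection_dotProduct_mulVec hs, rootReflection_involutive hA, ih]

theorem IsRealRoot.add (hA : IsGeneralizedCartanMatrix A) (hs : A.IsSymm) {v w : Q → ℤ}
    (hv : IsRealRoot A v) (hw : IsRealRoot A w) (h : v ⬝ᵥ A *ᵥ w = -1) :
    IsRealRoot A (v + w) := by
  induction hv using IsRealRoot.induction generalizing w with
  | single i =>
    have : Pi.single i 1 + w = FullHeapRep.rootReflection A i w := by
      rw [single_one_dotProduct] at h
      rw [rootReflection_eq, h]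
      module
    rw [this]
    exact hw.rootReflection i
  | reflect i v hv ih =>
    rw [rootReflection_dotProduct_mulVec hs] at h
    have := (ih (hw.rootReflection i) h).rootReflection i
    rwa [rootReflection_add, rootReflection_involutive hA] at this

theorem dotProduct_eq_neg_one_of_add (hA : IsGeneralizedCartanMatrix A) (hs : A.IsSymm)
    {v w : Q → ℤ} (hv : IsRealRoot A v) (hw : IsRealRoot A w) (hvw : IsRealRoot A (v + w)) :
    v ⬝ᵥ A *ᵥ w = -1 := by
  have h := hvw.norm_eq_two hA hs
  rw [Matrix.mulVec_add, dotProduct_add, add_dotProduct, add_dotProduct, hv.norm_eq_two hA hs,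
    hw.norm_eq_two hA hs, dotProduct_mulVec_comm hs w v] at h
  linarith

theorem corootReflection_eq (hs : A.IsSymm) (i : Q) (h : Q → ℤ) :
    corootReflection A i h = rootReflection A i h := by
  rw [corootReflection, rootReflection, ← Matrix.mulVec_transpose, hs.eq]

theorem IsCorootOf.eq (hs : A.IsSymm) {v h : Q → ℤ} (hv : IsCorootOf A v h) : h = v := by
  obtain ⟨w, i, rfl, rfl⟩ := hv
  congr 1
  ext i h
  rw [corootReflection_eq hs]

end Reflections

section RootWeights

variable {P : Type*} {A : Matrix P P ℤ} {E : Type*} [PartialOrder E]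
  [LocallyFiniteOrder E] {H : FullHeap A E}

theorem FullHeap.exists_gt_of_adj (H : FullHeap A E) {p q : P} (h : (dynkinGraph A).Adj p q)
    {x : E} (hx : H.label x = p) : ∃ y, H.label y = q ∧ x < y := by
  have hinj : Function.Injective (H.el q) := (H.el_strictMono q).injective
  by_contra! hcon
  have hle : ∀ n, H.el q n ≤ x := fun n => by
    rcases H.comparable (H.el q n) x (Or.inr (by rw [H.label_el, hx]; exact h.symm)) with h1 | h1
    · exact h1
    · rcases h1.eq_or_lt with h2 | h2
      · exact h2.ge
      · exact absurd h2 (hcon _ (H.label_el _ _))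
  have hinf : (Set.range fun n : ℕ => H.el q n).Infinite :=
    Set.infinite_range_of_injective (hinj.comp Nat.cast_injective)
  refine hinf ((Finset.finite_toSet (Finset.Icc (H.el q 0) x)).subset ?_)
  rintro _ ⟨n, rfl⟩
  simp only [Finset.coe_Icc, Set.mem_Icc]
  exact ⟨(H.el_strictMono q).monotone (by simp), hle n⟩

theorem FullHeap.exists_lt_of_adj (H : FullHeap A E) {p q : P} (h : (dynkinGraph A).Adj p q)
    {x : E} (hx : H.label x = p) : ∃ y, H.label y = q ∧ y < x := by
  have hinj : Function.Injective (H.el q) := (H.el_strictMono q).injective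
  by_contra! hcon
  have hle : ∀ n, x ≤ H.el q n := fun n => by
    rcases H.comparable x (H.el q n) (Or.inr (by rw [H.label_el, hx]; exact h)) with h1 | h1
    · exact h1
    · rcases h1.eq_or_lt with h2 | h2
      · exact h2.ge
      · exact absurd h2 (hcon _ (H.label_el _ _))
  have hinf : (Set.range fun n : ℕ => H.el q (-n)).Infinite :=
    Set.infinite_range_of_injective (hinj.comp (neg_injective.comp Nat.cast_injective))
  refine hinf ((Finset.finite_toSet (Finset.Icc x (H.el q 0))).subset ?_)
  rintro _ ⟨n, rfl⟩
  simp only [Finset.coe_Icc, Set.mem_Icc]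
  exact ⟨hle _, (H.el_strictMono q).monotone (by simp)⟩

theorem FullHeap.exists_gt_of_connected (H : FullHeap A E) (hc : (dynkinGraph A).Connected)
    (x : E) (q : P) : ∃ y, H.label y = q ∧ x < y := by
  obtain ⟨w⟩ := hc.preconnected (H.label x) q
  generalize hp : H.label x = p at w
  induction w generalizing x with
  | nil =>
    obtain ⟨y, hy, hxy⟩ := H.exists_gt x
    exact ⟨y, hy.trans hp, hxy⟩
  | cons h w ih =>
    obtain ⟨y, hy, hxy⟩ := H.exists_gt_of_adj h hp
    obtain ⟨z, hz, hyz⟩ := ih y hy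
    exact ⟨z, hz, hxy.trans hyz⟩

theorem FullHeap.exists_lt_of_connected (H : FullHeap A E) (hc : (dynkinGraph A).Connected)
    (x : E) (q : P) : ∃ y, H.label y = q ∧ y < x := by
  obtain ⟨w⟩ := hc.preconnected (H.label x) q
  generalize hp : H.label x = p at w
  induction w generalizing x with
  | nil =>
    obtain ⟨y, hy, hxy⟩ := H.exists_lt x
    exact ⟨y, hy.trans hp, hxy⟩
  | cons h w ih =>
    obtain ⟨y, hy, hxy⟩ := H.exists_lt_of_adj h hp
    obtain ⟨z, hz, hyz⟩ := ih y hy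
    exact ⟨z, hz, hyz.trans hxy⟩

variable [DecidableEq P]

theorem ProperIdeal.exists_reflection (hA : IsGeneralizedCartanMatrix A) (I : ProperIdeal H)
    (p : P) : ∃ J : ProperIdeal H, J.height = I.height - I.weight p • Pi.single p 1 := by
  have h := I.weight_mem hA p
  have : I.weight p = -1 ∨ I.weight p = 0 ∨ I.weight p = 1 := by omega
  rcases this with h | h | h
  · obtain ⟨J, hJ⟩ := I.exists_add_single hA h
    exact ⟨J, by rw [hJ, h]; simp⟩
  · exact ⟨I, by rw [h]; simp⟩
  · obtain ⟨J, hJ⟩ := I.exists_sub_single hA h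
    exact ⟨J, by rw [hJ, h]; simp⟩

variable [Fintype P]

theorem weight_dotProduct_of_reflection (hA : IsGeneralizedCartanMatrix A) (hs : A.IsSymm)
    {I J : ProperIdeal H} {p : P} (h : J.height = I.height - I.weight p • Pi.single p 1)
    (v : P → ℤ) : J.weight ⬝ᵥ v = I.weight ⬝ᵥ rootReflection A p v := by
  rw [I.weight_eq hA J, h, dotProduct_rootReflection, add_dotProduct, dotProduct_comm (A *ᵥ _),
    dotProduct_mulVec_comm hs, sub_sub_cancel_left, neg_dotProduct, smul_dotProduct,
    single_one_dotProduct, smul_eq_mul, sub_eq_add_neg]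

theorem IsRealRoot.weight_dotProduct (hA : IsGeneralizedCartanMatrix A) (hs : A.IsSymm)
    {v : P → ℤ} (hv : IsRealRoot A v) (I : ProperIdeal H) :
    -1 ≤ I.weight ⬝ᵥ v ∧ I.weight ⬝ᵥ v ≤ 1 := by
  induction hv using IsRealRoot.induction generalizing I with
  | single i =>
    rw [dotProduct_single_one]
    exact I.weight_mem hA i
  | reflect i v hv ih =>
    obtain ⟨J, hJ⟩ := I.exists_reflection hA i
    rw [← weight_dotProduct_of_reflection hA hs hJ]
    exact ih J

theorem IsRealRoot.exists_height_eq_add (hA : IsGeneralizedCartanMatrix A) (hs : A.IsSymm)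
    {v : P → ℤ} (hv : IsRealRoot A v) (I : ProperIdeal H) (h : I.weight ⬝ᵥ v = -1) :
    ∃ J : ProperIdeal H, J.height = I.height + v := by
  induction hv using IsRealRoot.induction generalizing I with
  | single i =>
    rw [dotProduct_single_one] at h
    exact I.exists_add_single hA h
  | reflect i v hv ih =>
    obtain ⟨J, hJ⟩ := I.exists_reflection hA i
    rw [← weight_dotProduct_of_reflection hA hs hJ] at h
    obtain ⟨K, hK⟩ := ih J h
    obtain ⟨L, hL⟩ := K.exists_reflection hA i
    refine ⟨L, ?_⟩
    have h1 := congrFun (J.weight_eq hA K) i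
    have h2 := congrFun (I.weight_eq hA J) i
    rw [hJ, sub_sub_cancel_left, Matrix.mulVec_neg, Matrix.mulVec_smul,
      Matrix.mulVec_single_one] at h2
    rw [hK, add_sub_cancel_left] at h1
    simp [hA.diag] at h1 h2
    rw [hL, h1, h2, hK, hJ, rootReflection_eq]
    module

theorem IsRealRoot.exists_height_iff (hA : IsGeneralizedCartanMatrix A) (hs : A.IsSymm)
    {v : P → ℤ} (hv : IsRealRoot A v) (I : ProperIdeal H) :
    (∃ J : ProperIdeal H, J.height = I.height + v) ↔ I.weight ⬝ᵥ v = -1 := by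
  refine ⟨fun ⟨J, hJ⟩ => ?_, hv.exists_height_eq_add hA hs I⟩
  have h1 := hv.weight_dotProduct hA hs I
  have h2 := hv.weight_dotProduct hA hs J
  rw [I.weight_eq hA J, hJ, add_sub_cancel_left, add_dotProduct, dotProduct_comm (A *ᵥ v),
    hv.norm_eq_two hA hs] at h2
  linarith

theorem FullHeap.exists_weight_eq_neg_one (H : FullHeap A E)
    (hA : IsGeneralizedCartanMatrix A) (hs : A.IsSymm) (hc : (dynkinGraph A).Connected) (p : P) :
    ∃ I : ProperIdeal H, I.weight p = -1 := by
  set b := H.el p 0 with hb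
  let I : ProperIdeal H := ⟨⟨{x | ¬ b ≤ x}, fun x y hyx hx h => hx (h.trans hyx)⟩, fun q => by
    obtain ⟨y, hy, hyb⟩ := H.exists_lt_of_connected hc b q
    obtain ⟨z, hz, hzb⟩ := H.exists_gt_of_connected hc b q
    exact ⟨⟨y, not_le_of_gt hyb, hy⟩, ⟨z, fun h => h hzb.le, hz⟩⟩⟩
  have hcar : I.carrier = {x | ¬ b ≤ x} := rfl
  have hadd : Addable {b} I := by
    refine ⟨?_, ?_⟩
    · rintro x y hyx (hx | hx)
      · exact Or.inl (I.lower hyx hx)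
      · simp only [Finset.coe_singleton, Set.mem_singleton_iff] at hx
        rw [hx] at hyx
        by_cases hy : b ≤ y
        · exact Or.inr (by simpa using hyx.antisymm hy)
        · exact Or.inl hy
    · simp [hcar]
  have hJ := hadd.height_union_eq (singleton_mem_heapsOfCharacter p 0)
  rw [natCast_single] at hJ
  have := ((IsRealRoot.single p).exists_height_iff hA hs I).1 ⟨_, hJ⟩
  exact ⟨I, by rwa [dotProduct_single_one] at this⟩

theorem IsRealRoot.exists_weight_dotProduct_eq (H : FullHeap A E)
    (hA : IsGeneralizedCartanMatrix A) (hs : A.IsSymm) (hc : (dynkinGraph A).Connected)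
    {v : P → ℤ} (hv : IsRealRoot A v) : ∃ I : ProperIdeal H, I.weight ⬝ᵥ v = -1 := by
  induction hv using IsRealRoot.induction with
  | single i =>
    obtain ⟨I, hI⟩ := H.exists_weight_eq_neg_one hA hs hc i
    exact ⟨I, by rwa [dotProduct_single_one]⟩
  | reflect i v hv ih =>
    obtain ⟨I, hI⟩ := ih
    obtain ⟨J, hJ⟩ := I.exists_reflection hA i
    refine ⟨J, ?_⟩
    rw [weight_dotProduct_of_reflection hA hs hJ, rootReflection_involutive hA, hI]

end RootWeights

section FiniteType

variable {Q : Type*} [Fintype Q] [DecidableEq Q] {A : Matrix Q Q ℤ}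

theorem even_dotProduct_mulVec (hA : IsGeneralizedCartanMatrix A) (hs : A.IsSymm) (v : Q → ℤ) :
    Even (v ⬝ᵥ A *ᵥ v) := by
  induction v using Pi.single_induction with
  | zero => simp
  | add v w hv hw =>
    rw [Matrix.mulVec_add, dotProduct_add, add_dotProduct, add_dotProduct,
      dotProduct_mulVec_comm hs w v]
    obtain ⟨a, ha⟩ := hv
    obtain ⟨b, hb⟩ := hw
    exact ⟨a + b + v ⬝ᵥ A *ᵥ w, by rw [ha, hb]; ring⟩
  | single i n =>
    refine ⟨n * n, ?_⟩
    simp [hA.diag]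
    ring

/-- The root lattice form is positive definite. -/
def IsPosDefOnLattice (A : Matrix Q Q ℤ) : Prop := ∀ v : Q → ℤ, v ≠ 0 → 0 < v ⬝ᵥ A *ᵥ v

theorem IsRealRoot.nonneg_or_nonpos (hA : IsGeneralizedCartanMatrix A) (hs : A.IsSymm)
    (hpd : IsPosDefOnLattice A) {v : Q → ℤ} (hv : IsRealRoot A v) : 0 ≤ v ∨ v ≤ 0 := by
  by_contra! hcon
  have h1 : v⁺ ≠ 0 := fun h => hcon.2 (posPart_eq_zero.1 h)
  have h2 : v⁻ ≠ 0 := fun h => hcon.1 (negPart_eq_zero.1 h)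
  have h3 : v⁺ ⬝ᵥ A *ᵥ v⁻ ≤ 0 := by
    rw [dotProduct]
    refine Finset.sum_nonpos fun i _ => ?_
    rw [Matrix.mulVec, dotProduct, Finset.mul_sum]
    refine Finset.sum_nonpos fun j _ => ?_
    have hp : 0 ≤ v⁺ i := (posPart_nonneg v) i
    have hn : 0 ≤ v⁻ j := (negPart_nonneg v) j
    by_cases hij : i = j
    · subst hij
      rcases le_total 0 (v i) with h | h
      · have : v⁻ i = 0 := by rw [Pi.negPart_apply, negPart_eq_zero.2 h]
        simp [this]
      · have : v⁺ i = 0 := by rw [Pi.posPart_apply, posPart_eq_zero.2 h]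
        simp [this]
    · exact mul_nonpos_of_nonneg_of_nonpos hp
        (mul_nonpos_of_nonpos_of_nonneg (hA.nonpos i j hij) hn)
  have h4 := hpd _ h1
  have h5 := hpd _ h2
  obtain ⟨a, ha⟩ := even_dotProduct_mulVec hA hs v⁺
  obtain ⟨b, hb⟩ := even_dotProduct_mulVec hA hs v⁻
  have h6 := hv.norm_eq_two hA hs
  rw [← posPart_sub_negPart v, Matrix.mulVec_sub, dotProduct_sub, sub_dotProduct, sub_dotProduct,
    dotProduct_mulVec_comm hs v⁻ v⁺] at h6
  omega

theorem IsRealRoot.eq_single_or_exists_sub (hA : IsGeneralizedCartanMatrix A) (hs : A.IsSymm)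
    (hpd : IsPosDefOnLattice A) {v : Q → ℤ} (hv : IsRealRoot A v) (h0 : 0 ≤ v) :
    (∃ i, v = Pi.single i 1) ∨
      ∃ i, IsRealRoot A (v - Pi.single i 1) ∧ 0 ≤ v - Pi.single i 1 := by
  have h2 := hv.norm_eq_two hA hs
  obtain ⟨i, -, hi⟩ : ∃ i ∈ Finset.univ, 0 < v i * (A *ᵥ v) i :=
    Finset.exists_lt_of_sum_lt (s := Finset.univ) (f := fun _ => (0 : ℤ)) (by
      rw [dotProduct] at h2
      rw [h2]
      simp)
  have hvi : 0 < v i := lt_of_le_of_ne (h0 i) fun h => by simp [← h] at hi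
  have hAi : 0 < (A *ᵥ v) i := pos_of_mul_pos_right hi hvi.le
  by_cases hu : v - Pi.single i 1 = 0
  · exact Or.inl ⟨i, sub_eq_zero.1 hu⟩
  · right
    have h3 := hpd _ hu
    rw [Matrix.mulVec_sub, dotProduct_sub, sub_dotProduct, sub_dotProduct, h2,
      dotProduct_mulVec_comm hs v, single_one_dotProduct, single_one_dotProduct,
      Matrix.mulVec_single_one, Matrix.col_apply, hA.diag] at h3
    have h4 : (A *ᵥ v) i = 1 := by omega
    refine ⟨i, ?_, ?_⟩
    · have := hv.rootReflection i
      rwa [rootReflection_eq, h4, one_smul] at this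
    · intro j
      by_cases hj : j = i
      · subst hj
        simpa using Int.add_one_le_of_lt hvi
      · simpa [hj] using h0 j

theorem IsRealRoot.nonneg_induction (hA : IsGeneralizedCartanMatrix A) (hs : A.IsSymm)
    (hpd : IsPosDefOnLattice A) {motive : (Q → ℤ) → Prop}
    (single : ∀ i, motive (Pi.single i 1))
    (add : ∀ i v, IsRealRoot A v → IsRealRoot A (Pi.single i 1 + v) → 0 ≤ v → motive v →
      motive (Pi.single i 1 + v))
    {v : Q → ℤ} (hv : IsRealRoot A v) (h0 : 0 ≤ v) : motive v := by
  obtain ⟨n, hn⟩ : ∃ n : ℕ, ∑ i, v i = n :=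
    Int.eq_ofNat_of_zero_le (Finset.sum_nonneg fun i _ => h0 i)
  induction n generalizing v with
  | zero =>
    have h1 := (Finset.sum_eq_zero_iff_of_nonneg fun i _ => h0 i).1 hn
    have h2 := hv.norm_eq_two hA hs
    rw [show v = 0 from funext fun i => h1 i (Finset.mem_univ i)] at h2
    simp at h2
  | succ n ih =>
    rcases hv.eq_single_or_exists_sub hA hs hpd h0 with ⟨i, rfl⟩ | ⟨i, hi, hi0⟩
    · exact single i
    · have := add i _ hi (by rwa [add_sub_cancel]) hi0 (ih hi hi0 (by
        simp only [Pi.sub_apply, Finset.sum_sub_distrib, hn, Fintype.sum_pi_single']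
        push_cast
        ring))
      rwa [add_sub_cancel] at this

theorem IsRealRoot.dotProduct_nonneg (hA : IsGeneralizedCartanMatrix A) (hs : A.IsSymm)
    (hpd : IsPosDefOnLattice A) {v w : Q → ℤ} (hv : IsRealRoot A v) (hw : IsRealRoot A w)
    (h0 : v + w ≠ 0) (h : ¬ IsRealRoot A (v + w)) : 0 ≤ v ⬝ᵥ A *ᵥ w := by
  have h1 := hpd _ h0
  rw [Matrix.mulVec_add, dotProduct_add, add_dotProduct, add_dotProduct, hv.norm_eq_two hA hs,
    hw.norm_eq_two hA hs, dotProduct_mulVec_comm hs w v] at h1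
  have h2 : v ⬝ᵥ A *ᵥ w ≠ -1 := fun h2 => h (hv.add hA hs hw h2)
  omega

end FiniteType

theorem deleteVertex_isSymm {P : Type*} {A : Matrix P P ℤ} {o : P} (hs : A.IsSymm) :
    (deleteVertex A o).IsSymm :=
  hs.submatrix _

section Extend

variable {P : Type*} [DecidableEq P] {o : P}

/-- Extension by zero of an integral vector to the vertex `o`. -/
def extend (o : P) (v : {p : P // p ≠ o} → ℤ) : P → ℤ :=
  fun p => if h : p = o then 0 else v ⟨p, h⟩

@[simp] theorem extend_self (v : {p : P // p ≠ o} → ℤ) : extend o v o = 0 := by simp [extend]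

@[simp] theorem extend_coe (v : {p : P // p ≠ o} → ℤ) (i : {p : P // p ≠ o}) :
    extend o v i.1 = v i := by simp [extend, i.2]

theorem extend_ext {v : {p : P // p ≠ o} → ℤ} {w : P → ℤ} (ho : w o = 0)
    (h : ∀ i : {p : P // p ≠ o}, w i.1 = v i) : extend o v = w := by
  ext p
  by_cases hp : p = o
  · subst hp; simp [ho]
  · exact (extend_coe v ⟨p, hp⟩).trans (h ⟨p, hp⟩).symm

theorem extend_injective : Function.Injective (extend o) := by
  intro v w h
  ext i
  rw [← extend_coe v, h, extend_coe]

theorem extend_add (v w : {p : P // p ≠ o} → ℤ) : extend o (v + w) = extend o v + extend o w :=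
  extend_ext (by simp) (by simp)

theorem extend_sub (v w : {p : P // p ≠ o} → ℤ) : extend o (v - w) = extend o v - extend o w :=
  extend_ext (by simp) (by simp)

theorem extend_neg (v : {p : P // p ≠ o} → ℤ) : extend o (-v) = -extend o v :=
  extend_ext (by simp) (by simp)

theorem extend_single (i : {p : P // p ≠ o}) (n : ℤ) :
    extend o (Pi.single i n) = Pi.single i.1 n := by
  refine extend_ext (by simp [i.2.symm]) fun j => ?_
  by_cases h : j = i
  · subst h; simp
  · simp [h, Subtype.coe_ne_coe.2 h]

theorem extend_natCast (α : {p : P // p ≠ o} → ℕ) :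
    (fun p => (extendByZero o α p : ℤ)) = extend o (fun i => (α i : ℤ)) := by
  ext p
  by_cases h : p = o <;> simp [extendByZero, extend, h]

variable [Fintype P]

@[to_additive]
theorem prod_eq_prod_ne {M : Type*} [CommMonoid M] {f : P → M} (h : f o = 1) :
    ∏ p, f p = ∏ i : {p : P // p ≠ o}, f i.1 := by
  rw [← Finset.mul_prod_erase Finset.univ f (Finset.mem_univ o), h, one_mul]
  exact Finset.prod_subtype _ (by simp) f

theorem dotProduct_extend (w : P → ℤ) (v : {p : P // p ≠ o} → ℤ) :
    w ⬝ᵥ extend o v = ∑ i : {p : P // p ≠ o}, w i.1 * v i := by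
  rw [dotProduct, sum_eq_sum_ne (o := o) (by simp)]
  simp

theorem mulVec_extend (A : Matrix P P ℤ) (v : {p : P // p ≠ o} → ℤ) (i : {p : P // p ≠ o}) :
    (A *ᵥ extend o v) i.1 = (deleteVertex A o *ᵥ v) i := by
  rw [Matrix.mulVec, dotProduct_extend]
  rfl

theorem extend_dotProduct_mulVec (A : Matrix P P ℤ) (v w : {p : P // p ≠ o} → ℤ) :
    extend o v ⬝ᵥ A *ᵥ extend o w = v ⬝ᵥ deleteVertex A o *ᵥ w := by
  rw [dotProduct_comm, dotProduct_extend, dotProduct_comm]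
  simp [mulVec_extend, dotProduct]

theorem extend_rootReflection (A : Matrix P P ℤ) (v : {p : P // p ≠ o} → ℤ)
    (i : {p : P // p ≠ o}) :
    extend o (rootReflection (deleteVertex A o) i v) = rootReflection A i.1 (extend o v) := by
  rw [rootReflection, extend_sub, extend_single, rootReflection, mulVec_extend]

theorem IsRealRoot.extend {A : Matrix P P ℤ} {v : {p : P // p ≠ o} → ℤ}
    (hv : IsRealRoot (deleteVertex A o) v) : IsRealRoot A (extend o v) := by
  induction hv using IsRealRoot.induction with
  | single i =>
    rw [extend_single]
    exact IsRealRoot.single _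
  | reflect i v hv ih =>
    rw [extend_rootReflection]
    exact ih.rootReflection _

theorem asymmetry_extend (arrow : P → P → Prop) (v w : {p : P // p ≠ o} → ℤ) :
    asymmetry (sgn arrow) (extend o v) (extend o w) =
      asymmetry (fun i j : {p : P // p ≠ o} => sgn arrow i.1 j.1) v w := by
  rw [asymmetry, prod_eq_prod_ne (o := o) (by simp), asymmetry]
  refine Finset.prod_congr rfl fun i _ => ?_
  rw [prod_eq_prod_ne (o := o) (by simp)]
  simp

/-- Deleting a vertex from a connected diagram with a positive null vector leaves a positive
definite form. -/
theorem isPosDefOnLattice_deleteVertex {A : Matrix P P ℤ} (hA : IsGeneralizedCartanMatrix A)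
    (hs : A.IsSymm) (hc : (dynkinGraph A).Connected) {δ : P → ℤ} (hδ : IsNullRoot A δ) (o : P) :
    IsPosDefOnLattice (deleteVertex A o) := by
  intro v hv
  rw [← extend_dotProduct_mulVec]
  set u := extend o v with hu
  let x : P → ℚ := fun p => u p / δ p
  have hδ0 : ∀ p, (0 : ℚ) < δ p := fun p => by exact_mod_cast hδ.pos p
  have hx : ∀ p, (u p : ℚ) = δ p * x p := fun p => by
    have := (hδ0 p).ne'
    simp only [x]
    field_simp
  have hnull : ∀ p, ∑ q, (A p q : ℚ) * δ q = 0 := fun p => by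
    have := congrFun hδ.null p
    rw [Matrix.mulVec, dotProduct] at this
    exact_mod_cast this
  have hnull' : ∀ q, ∑ p, (A p q : ℚ) * δ p = 0 := fun q => by
    rw [← hnull q]
    exact Finset.sum_congr rfl fun p _ => by rw [hs.apply]
  have hterm : ∀ p q, 0 ≤ -((A p q : ℚ) * δ p * δ q * (x p - x q) ^ 2) := fun p q => by
    by_cases h : p = q
    · subst h; simp
    · have : (A p q : ℚ) ≤ 0 := by exact_mod_cast hA.nonpos p q h
      have h1 := mul_nonneg (hδ0 p).le (hδ0 q).le
      nlinarith [mul_nonneg (mul_nonneg h1 (sq_nonneg (x p - x q))) (neg_nonneg.2 this)]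
  have key : (2 : ℚ) * (u ⬝ᵥ A *ᵥ u : ℤ) =
      ∑ p, ∑ q, -((A p q : ℚ) * δ p * δ q * (x p - x q) ^ 2) := by
    have e1 : ∑ p, ∑ q, (A p q : ℚ) * δ p * δ q * x p ^ 2 = 0 := by
      refine Finset.sum_eq_zero fun p _ => ?_
      have : ∀ q, (A p q : ℚ) * δ p * δ q * x p ^ 2 = δ p * x p ^ 2 * (A p q * δ q) :=
        fun q => by ring
      simp only [this, ← Finset.mul_sum, hnull, mul_zero]
    have e2 : ∑ p, ∑ q, (A p q : ℚ) * δ p * δ q * x q ^ 2 = 0 := by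
      rw [Finset.sum_comm]
      refine Finset.sum_eq_zero fun q _ => ?_
      have : ∀ p, (A p q : ℚ) * δ p * δ q * x q ^ 2 = δ q * x q ^ 2 * (A p q * δ p) :=
        fun p => by ring
      simp only [this, ← Finset.mul_sum, hnull', mul_zero]
    have e3 : ((u ⬝ᵥ A *ᵥ u : ℤ) : ℚ) = ∑ p, ∑ q, (A p q : ℚ) * δ p * δ q * (x p * x q) := by
      simp only [dotProduct, Matrix.mulVec, Int.cast_sum, Int.cast_mul, Finset.mul_sum]
      refine Finset.sum_congr rfl fun p _ => Finset.sum_congr rfl fun q _ => ?_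
      rw [hx, hx]
      ring
    have e4 : ∀ p q, -((A p q : ℚ) * δ p * δ q * (x p - x q) ^ 2) =
        2 * (A p q * δ p * δ q * (x p * x q)) - A p q * δ p * δ q * x p ^ 2
          - A p q * δ p * δ q * x q ^ 2 := fun p q => by ring
    simp only [e4, Finset.sum_sub_distrib, e1, e2, sub_zero, ← Finset.mul_sum, e3]
  have hnn : 0 ≤ ∑ p, ∑ q, -((A p q : ℚ) * δ p * δ q * (x p - x q) ^ 2) :=
    Finset.sum_nonneg fun p _ => Finset.sum_nonneg fun q _ => hterm p q
  have hge : (0 : ℚ) ≤ (u ⬝ᵥ A *ᵥ u : ℤ) := by linarith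
  rcases (Int.cast_nonneg_iff.1 hge).lt_or_eq with h | h
  · exact h
  exfalso
  rw [← h, Int.cast_zero, mul_zero] at key
  have hz : ∀ p q, -((A p q : ℚ) * δ p * δ q * (x p - x q) ^ 2) = 0 := fun p q =>
    (Finset.sum_eq_zero_iff_of_nonneg fun q _ => hterm p q).1
      ((Finset.sum_eq_zero_iff_of_nonneg fun p _ => Finset.sum_nonneg fun q _ => hterm p q).1
        key.symm p (Finset.mem_univ p)) q (Finset.mem_univ q)
  have hadj : ∀ p q, (dynkinGraph A).Adj p q → x p = x q := fun p q hpq => by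
    have h1 := hz p q
    have h2 : (A p q : ℚ) ≠ 0 := by exact_mod_cast ((adj_iff hA p q).1 hpq).2
    have h3 := (hδ0 p).ne'
    have h4 := (hδ0 q).ne'
    simp only [neg_eq_zero, mul_eq_zero, h2, h3, h4, false_or] at h1
    exact sub_eq_zero.1 (by simpa using h1)
  have hconst : ∀ p, x p = 0 := fun p => by
    obtain ⟨w⟩ := hc.preconnected p o
    have : ∀ {a b : P}, (dynkinGraph A).Walk a b → x a = x b := fun w => by
      induction w with
      | nil => rfl
      | cons h w ih => exact (hadj _ _ h).trans ih
    rw [this w]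
    simp [x, hu]
  apply hv
  ext i
  have := hx i.1
  rw [hconst, mul_zero, hu, extend_coe] at this
  exact_mod_cast this

end Extend

section Asymmetry

variable {Q : Type*} [Fintype Q] (sg : Q → Q → ℤˣ)

theorem asymmetry_add_left (u v w : Q → ℤ) :
    asymmetry sg (u + v) w = asymmetry sg u w * asymmetry sg v w := by
  simp only [asymmetry, Pi.add_apply, add_mul, zpow_add, Finset.prod_mul_distrib]

theorem asymmetry_add_right (u v w : Q → ℤ) :
    asymmetry sg u (v + w) = asymmetry sg u v * asymmetry sg u w := by
  simp only [asymmetry, Pi.add_apply, mul_add, zpow_add, Finset.prod_mul_distrib]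

@[simp] theorem asymmetry_zero_left (w : Q → ℤ) : asymmetry sg 0 w = 1 := by
  simp [asymmetry]

@[simp] theorem asymmetry_zero_right (w : Q → ℤ) : asymmetry sg w 0 = 1 := by
  simp [asymmetry]

theorem asymmetry_neg_left (v w : Q → ℤ) : asymmetry sg (-v) w = asymmetry sg v w := by
  have := asymmetry_add_left sg (-v) v w
  rw [neg_add_cancel, asymmetry_zero_left] at this
  rw [← mul_one (asymmetry sg (-v) w), ← Int.units_mul_self (asymmetry sg v w), ← mul_assoc,
    ← this, one_mul]

theorem asymmetry_neg_right (v w : Q → ℤ) : asymmetry sg v (-w) = asymmetry sg v w := by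
  have := asymmetry_add_right sg v (-w) w
  rw [neg_add_cancel, asymmetry_zero_right] at this
  rw [← mul_one (asymmetry sg v (-w)), ← Int.units_mul_self (asymmetry sg v w), ← mul_assoc,
    ← this, one_mul]

theorem asymmetry_zsmul_left (n : ℤ) (v w : Q → ℤ) :
    asymmetry sg (n • v) w = asymmetry sg v w ^ n := by
  simp only [asymmetry, Pi.smul_apply, smul_eq_mul, ← Finset.prod_zpow, ← zpow_mul]
  exact Finset.prod_congr rfl fun i _ => Finset.prod_congr rfl fun j _ => by congr 1; ring

theorem asymmetry_zsmul_right (n : ℤ) (v w : Q → ℤ) :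
    asymmetry sg v (n • w) = asymmetry sg v w ^ n := by
  simp only [asymmetry, Pi.smul_apply, smul_eq_mul, ← Finset.prod_zpow, ← zpow_mul]
  exact Finset.prod_congr rfl fun i _ => Finset.prod_congr rfl fun j _ => by congr 1; ring

theorem asymmetry_single_single [DecidableEq Q] (i j : Q) :
    asymmetry sg (Pi.single i 1) (Pi.single j 1) = sg i j := by
  rw [asymmetry, Finset.prod_eq_single i, Finset.prod_eq_single j]
  · simp
  · intro b _ hb
    simp [hb]
  · simp
  · intro b _ hb
    simp [hb]
  · simp

theorem zpow_finsetSum {G ι : Type*} [CommGroup G] (g : G) (s : Finset ι) (f : ι → ℤ) :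
    g ^ ∑ i ∈ s, f i = ∏ i ∈ s, g ^ f i := by
  classical
  induction s using Finset.induction_on with
  | empty => simp
  | insert a s ha ih => rw [Finset.sum_insert ha, Finset.prod_insert ha, zpow_add, ih]

variable {A : Matrix Q Q ℤ} {arrow : Q → Q → Prop}

theorem sgn_self {P : Type*} (arrow : P → P → Prop) (p : P) : sgn arrow p p = -1 := by simp [sgn]

theorem sgn_eq_one {P : Type*} {A : Matrix P P ℤ} {arrow : P → P → Prop}
    (h : IsOrientation A arrow) {p q : P} (hpq : ¬ Concurrent A p q) : sgn arrow p q = 1 :=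
  if_neg fun h1 => hpq (h1.imp id fun h2 => h.adj_of_arrow _ _ h2)

theorem sgn_mul_sgn {P : Type*} {A : Matrix P P ℤ} {arrow : P → P → Prop}
    (hA : IsGeneralizedCartanMatrix A) (hsl : A.IsSimplyLaced)
    (h : IsOrientation A arrow) (p q : P) : sgn arrow p q * sgn arrow q p = (-1) ^ A p q := by
  by_cases hpq : p = q
  · subst hpq
    rw [sgn_self, hA.diag]
    rfl
  · by_cases hadj : (dynkinGraph A).Adj p q
    · have h1 : A p q = -1 := (hsl hpq).resolve_left ((adj_iff hA p q).1 hadj).2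
      rw [h1]
      rcases h.xor_of_adj p q hadj with h2 | h2 <;>
        simp [sgn, hpq, Ne.symm hpq, h2.1, h2.2]
    · have h0 : A p q = 0 := by
        by_contra h0
        exact hadj ((adj_iff hA p q).2 ⟨hpq, h0⟩)
      rw [sgn_eq_one h (p := p) (q := q) (by rintro (h1 | h1); exacts [hpq h1, hadj h1]),
        sgn_eq_one h (p := q) (q := p) (by
          rintro (h1 | h1); exacts [hpq h1.symm, hadj h1.symm]), h0]
      rfl

theorem asymmetry_mul_flip (hA : IsGeneralizedCartanMatrix A) (hsl : A.IsSimplyLaced)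
    (h : IsOrientation A arrow) (v w : Q → ℤ) :
    asymmetry (sgn arrow) v w * asymmetry (sgn arrow) w v = (-1) ^ (v ⬝ᵥ A *ᵥ w) := by
  have h1 : asymmetry (sgn arrow) w v = ∏ i, ∏ j, sgn arrow j i ^ (v i * w j) := by
    rw [asymmetry, Finset.prod_comm]
    simp only [mul_comm]
  rw [h1, asymmetry]
  simp only [← Finset.prod_mul_distrib, ← mul_zpow, sgn_mul_sgn hA hsl h,
    dotProduct, Matrix.mulVec, Finset.mul_sum, zpow_finsetSum, ← zpow_mul]
  exact Finset.prod_congr rfl fun i _ => Finset.prod_congr rfl fun j _ => by congr 1; ring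

theorem IsRealRoot.asymmetry_self [DecidableEq Q] (hA : IsGeneralizedCartanMatrix A)
    (hsl : A.IsSimplyLaced) (h : IsOrientation A arrow) {v : Q → ℤ} (hv : IsRealRoot A v) :
    asymmetry (sgn arrow) v v = -1 := by
  induction hv using IsRealRoot.induction with
  | single i => rw [asymmetry_single_single, sgn_self]
  | reflect i v hv ih =>
    set m := (A *ᵥ v) i with hm
    have h1 := asymmetry_mul_flip hA hsl h (Pi.single i 1) v
    rw [single_one_dotProduct, ← hm] at h1
    rw [rootReflection_eq, ← hm, sub_eq_add_neg, asymmetry_add_left, asymmetry_add_right,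
      asymmetry_add_right, asymmetry_neg_left, asymmetry_neg_left, asymmetry_neg_right,
      asymmetry_neg_right, asymmetry_zsmul_left, asymmetry_zsmul_left, asymmetry_zsmul_right,
      asymmetry_zsmul_right, asymmetry_single_single, sgn_self, ih]
    calc _ = -1 * ((asymmetry (sgn arrow) (Pi.single i 1) v *
          asymmetry (sgn arrow) v (Pi.single i 1)) ^ m * ((-1) ^ m) ^ m) := by
          rw [mul_zpow]; ac_rfl
      _ = -1 := by rw [h1, Int.units_mul_self, mul_one]

end Asymmetry

section Signs

variable {P : Type*} {A : Matrix P P ℤ} {E : Type*} [PartialOrder E]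
  [LocallyFiniteOrder E] {H : FullHeap A E} {arrow : P → P → Prop}

open Classical in
theorem parity_eq_prod (H : FullHeap A E) (arrow : P → P → Prop) (L : Finset E) :
    parity H arrow L = ∏ x ∈ L, ∏ y ∈ L,
      if y < x then sgn arrow (H.label x) (H.label y) else 1 := by
  rw [parity, Finset.prod_filter, Finset.prod_product]

theorem parity_empty : parity H arrow ∅ = 1 := by simp [parity]

variable [Fintype P]

theorem idealDiff_union [DecidableEq E] {I J K : ProperIdeal H} (hIJ : I.height ≤ J.height)
    (hJK : J.height ≤ K.height) : idealDiff I K = idealDiff J K ∪ idealDiff I J := by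
  ext x
  have h1 : x ∈ I.carrier → x ∈ J.carrier := fun h => ProperIdeal.carrier_subset_iff.2 hIJ h
  have h2 : x ∈ J.carrier → x ∈ K.carrier := fun h => ProperIdeal.carrier_subset_iff.2 hJK h
  simp only [Finset.mem_union, mem_idealDiff]
  tauto

theorem prod_idealDiff [DecidableEq P] {I J : ProperIdeal H} (h : I.height ≤ J.height)
    (f : P → ℤˣ) :
    ∏ x ∈ idealDiff I J, f (H.label x) = ∏ p, f p ^ (J.height p - I.height p) := by
  rw [← Finset.prod_fiberwise (idealDiff I J) H.label]
  refine Finset.prod_congr rfl fun p _ => ?_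
  rw [← card_filter_idealDiff h p, zpow_natCast]
  exact Finset.prod_eq_pow_card fun x hx => by rw [(Finset.mem_filter.1 hx).2]

theorem parity_idealDiff_mul [DecidableEq P] (ho : IsOrientation A arrow) {I J K : ProperIdeal H}
    (hIJ : I.height ≤ J.height) (hJK : J.height ≤ K.height) :
    parity H arrow (idealDiff I K) = parity H arrow (idealDiff J K) *
      parity H arrow (idealDiff I J) *
      asymmetry (sgn arrow) (K.height - J.height) (J.height - I.height) := by
  classical
  have hdisj : Disjoint (idealDiff J K) (idealDiff I J) := by
    rw [Finset.disjoint_left]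
    intro x hx hx'
    exact (mem_idealDiff.1 hx).2 (mem_idealDiff.1 hx').1
  have hcross : ∏ x ∈ idealDiff J K, ∏ y ∈ idealDiff I J,
      (if y < x then sgn arrow (H.label x) (H.label y) else 1) =
      asymmetry (sgn arrow) (K.height - J.height) (J.height - I.height) := by
    have : ∀ x ∈ idealDiff J K, ∀ y ∈ idealDiff I J,
        (if y < x then sgn arrow (H.label x) (H.label y) else 1) =
          sgn arrow (H.label x) (H.label y) := by
      intro x hx y hy
      rw [mem_idealDiff] at hx hy
      split_ifs with h
      · rfl
      · rw [sgn_eq_one ho]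
        intro hc
        rcases H.comparable x y hc with h1 | h1
        · exact hx.2 (J.lower h1 hy.1)
        · refine h (lt_of_le_of_ne h1 ?_)
          rintro rfl
          exact hx.2 hy.1
    rw [Finset.prod_congr rfl fun x hx => Finset.prod_congr rfl fun y hy => this x hx y hy]
    rw [Finset.prod_congr rfl fun x _ => prod_idealDiff hIJ (fun q => sgn arrow (H.label x) q),
      prod_idealDiff hJK (fun p => ∏ q, sgn arrow p q ^ (J.height q - I.height q)), asymmetry]
    simp only [← Finset.prod_zpow, ← zpow_mul, Pi.sub_apply]
    exact Finset.prod_congr rfl fun i _ => Finset.prod_congr rfl fun j _ => by congr 1; ring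
  have hcross' : ∏ x ∈ idealDiff I J, ∏ y ∈ idealDiff J K,
      (if y < x then sgn arrow (H.label x) (H.label y) else 1) = 1 := by
    refine Finset.prod_eq_one fun x hx => Finset.prod_eq_one fun y hy => if_neg fun h => ?_
    exact (mem_idealDiff.1 hy).2 (J.lower h.le (mem_idealDiff.1 hx).1)
  simp only [parity_eq_prod, idealDiff_union hIJ hJK, Finset.prod_union hdisj,
    Finset.prod_mul_distrib, hcross, hcross']
  rw [one_mul]
  ac_rfl

theorem idealDiff_self (I : ProperIdeal H) : idealDiff I I = ∅ := by
  ext x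
  simp [mem_idealDiff]

/-- The sign with which the operator of degree `J.height - I.height` maps `v_I` to `v_J`. -/
def shiftSign (arrow : P → P → Prop) (I J : ProperIdeal H) : ℤˣ :=
  parity H arrow (idealDiff (I.inf J) I) * parity H arrow (idealDiff (I.inf J) J) *
    asymmetry (sgn arrow) (J.height - I.height) (I.height - (I.inf J).height)

variable [DecidableEq P]

theorem shiftSign_eq (ho : IsOrientation A arrow) {I J M : ProperIdeal H}
    (hI : M.height ≤ I.height) (hJ : M.height ≤ J.height) :
    shiftSign arrow I J = parity H arrow (idealDiff M I) * parity H arrow (idealDiff M J) *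
      asymmetry (sgn arrow) (J.height - I.height) (I.height - M.height) := by
  have hK : M.height ≤ (I.inf J).height := by
    rw [ProperIdeal.height_inf]; exact le_inf hI hJ
  have hKI : (I.inf J).height ≤ I.height := by
    rw [ProperIdeal.height_inf]; exact inf_le_left
  have hKJ : (I.inf J).height ≤ J.height := by
    rw [ProperIdeal.height_inf]; exact inf_le_right
  rw [parity_idealDiff_mul ho hK hKI, parity_idealDiff_mul ho hK hKJ, shiftSign]
  set a := I.height - (I.inf J).height
  set b := J.height - (I.inf J).height
  set c := (I.inf J).height - M.height
  have h1 : J.height - I.height = b + -a := by simp only [a, b]; abel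
  have h2 : I.height - M.height = a + c := by simp only [a, c]; abel
  rw [h1, h2, asymmetry_add_right _ (b + -a), asymmetry_add_left _ b (-a) c, asymmetry_neg_left]
  have e1 := Int.units_mul_self (parity H arrow (idealDiff M (I.inf J)))
  have e2 := Int.units_mul_self (asymmetry (sgn arrow) a c)
  have e3 := Int.units_mul_self (asymmetry (sgn arrow) b c)
  generalize parity H arrow (idealDiff M (I.inf J)) = x at *
  generalize asymmetry (sgn arrow) a c = y at *
  generalize asymmetry (sgn arrow) b c = z at *
  calc _ = parity H arrow (idealDiff (I.inf J) I) * parity H arrow (idealDiff (I.inf J) J) *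
    asymmetry (sgn arrow) (b + -a) a * (x * x) * (y * y) * (z * z) := by simp [e1, e2, e3]
    _ = _ := by ac_rfl

theorem shiftSign_of_le (ho : IsOrientation A arrow) {I J : ProperIdeal H}
    (h : I.height ≤ J.height) : shiftSign arrow I J = parity H arrow (idealDiff I J) := by
  rw [shiftSign_eq ho le_rfl h, idealDiff_self, parity_empty, sub_self]
  simp

theorem shiftSign_of_ge (ho : IsOrientation A arrow) {I J : ProperIdeal H}
    (h : J.height ≤ I.height) : shiftSign arrow I J = parity H arrow (idealDiff J I) *
      asymmetry (sgn arrow) (I.height - J.height) (I.height - J.height) := by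
  rw [shiftSign_eq ho h le_rfl, idealDiff_self, parity_empty, ← neg_sub I.height J.height,
    asymmetry_neg_left, mul_one]

theorem shiftSign_self (ho : IsOrientation A arrow) (I : ProperIdeal H) :
    shiftSign arrow I I = 1 := by
  rw [shiftSign_of_le ho le_rfl, idealDiff_self, parity_empty]

theorem shiftSign_mul (ho : IsOrientation A arrow) (I J K : ProperIdeal H) :
    shiftSign arrow I J * shiftSign arrow J K =
      asymmetry (sgn arrow) (K.height - J.height) (J.height - I.height) *
        shiftSign arrow I K := by
  set M := (I.inf J).inf K with hM
  have hMh : M.height = (I.height ⊓ J.height) ⊓ K.height := by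
    rw [hM, ProperIdeal.height_inf, ProperIdeal.height_inf]
  have hI : M.height ≤ I.height := by rw [hMh]; exact inf_le_left.trans inf_le_left
  have hJ : M.height ≤ J.height := by rw [hMh]; exact inf_le_left.trans inf_le_right
  have hK : M.height ≤ K.height := by rw [hMh]; exact inf_le_right
  rw [shiftSign_eq ho hI hJ, shiftSign_eq ho hJ hK, shiftSign_eq ho hI hK]
  set a := J.height - I.height
  set b := K.height - J.height
  set c := I.height - M.height
  have h1 : K.height - I.height = a + b := by simp only [a, b]; abel
  have h2 : J.height - M.height = a + c := by simp only [a, c]; abel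
  rw [h1, h2, asymmetry_add_right _ b, asymmetry_add_left _ a b c]
  have e1 := Int.units_mul_self (parity H arrow (idealDiff M J))
  generalize parity H arrow (idealDiff M J) = x at *
  calc _ = parity H arrow (idealDiff M I) * parity H arrow (idealDiff M K) *
    asymmetry (sgn arrow) a c * asymmetry (sgn arrow) b a * asymmetry (sgn arrow) b c *
    (x * x) := by ac_rfl
    _ = _ := by rw [e1]; simp only [mul_one]; ac_rfl

end Signs

/-- The bracket of two endomorphisms is their commutator. -/
theorem end_lie_apply {k V : Type*} [Field k] [AddCommGroup V] [Module k V]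
    (f g : Module.End k V) (v : V) : ⁅f, g⁆ v = f (g v) - g (f v) := rfl

theorem end_lie_eq {k V : Type*} [Field k] [AddCommGroup V] [Module k V]
    (f g : Module.End k V) : ⁅f, g⁆ = f * g - g * f := rfl

theorem end_smul_lie {k V : Type*} [Field k] [AddCommGroup V] [Module k V] (c : k)
    (f g : Module.End k V) : ⁅c • f, g⁆ = c • ⁅f, g⁆ := by
  simp only [end_lie_eq, smul_mul_assoc, mul_smul_comm, smul_sub]

theorem end_lie_smul {k V : Type*} [Field k] [AddCommGroup V] [Module k V] (c : k)
    (f g : Module.End k V) : ⁅f, c • g⁆ = c • ⁅f, g⁆ := by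
  simp only [end_lie_eq, smul_mul_assoc, mul_smul_comm, smul_sub]

theorem end_lie_neg {k V : Type*} [Field k] [AddCommGroup V] [Module k V]
    (f g : Module.End k V) : ⁅f, -g⁆ = -⁅f, g⁆ := by
  simp only [end_lie_eq, mul_neg, neg_mul]
  abel

theorem end_neg_ne_zero {k V : Type*} [Field k] [AddCommGroup V] [Module k V]
    {f : Module.End k V} (h : f ≠ 0) : -f ≠ 0 := by
  simpa using h

theorem end_zsmul_neg {k V : Type*} [Field k] [AddCommGroup V] [Module k V] (n : ℤ)
    (f : Module.End k V) : n • -f = -(n • f) := by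
  simp

theorem end_intCast_smul {k V : Type*} [Field k] [AddCommGroup V] [Module k V] (n : ℤ)
    (f : Module.End k V) : (n : k) • f = n • f := Int.cast_smul_eq_zsmul k n f

section Operators

variable {P : Type*} {A : Matrix P P ℤ} {E : Type*} [PartialOrder E]
  [LocallyFiniteOrder E] {H : FullHeap A E} {arrow : P → P → Prop} {k : Type*} [Field k]

theorem le_of_height_eq_add {χ : P → ℕ} {I J : ProperIdeal H}
    (hJ : J.height = I.height + fun p => (χ p : ℤ)) : I.height ≤ J.height := by
  rw [hJ]
  intro p
  simp

theorem hom_ext_basisVec {f g : Module.End k (VSpace k H)}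
    (h : ∀ I, f (basisVec k I) = g (basisVec k I)) : f = g :=
  Finsupp.lhom_ext' fun I => LinearMap.ext_ring (h I)

theorem opX_basisVec {L : Finset E} {I : ProperIdeal H} (h : Addable L I) :
    opX k H L (basisVec k I) = basisVec k (I.union L h) := by
  simp [opX, basisVec, h]

theorem opX_basisVec_of_not {L : Finset E} {I : ProperIdeal H} (h : ¬ Addable L I) :
    opX k H L (basisVec k I) = 0 := by
  simp [opX, basisVec, h]

theorem opY_basisVec {L : Finset E} {I : ProperIdeal H} (h : Removable L I) :
    opY k H L (basisVec k I) = basisVec k (I.sdiff L h) := by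
  simp [opY, basisVec, h]

theorem opY_basisVec_of_not {L : Finset E} {I : ProperIdeal H} (h : ¬ Removable L I) :
    opY k H L (basisVec k I) = 0 := by
  simp [opY, basisVec, h]

open Classical in
theorem opH_basisVec (L : Finset E) (I : ProperIdeal H) :
    opH k H L (basisVec k I) = if Removable L I ∧ ¬ Addable L I then basisVec k I
      else if Addable L I ∧ ¬ Removable L I then -basisVec k I else 0 := by
  simp [opH, basisVec]

theorem pointwiseSum_basisVec (S : Set (Finset E)) (T : Finset E → Module.End k (VSpace k H))
    (I : ProperIdeal H) :
    pointwiseSum k S T (basisVec k I) = ∑ᶠ (L : Finset E) (_ : L ∈ S), T L (basisVec k I) := by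
  simp [pointwiseSum, basisVec]

theorem pointwiseSum_basisVec_eq {S : Set (Finset E)} {T : Finset E → Module.End k (VSpace k H)}
    {I : ProperIdeal H} {L : Finset E} (hL : L ∈ S)
    (h : ∀ M ∈ S, M ≠ L → T M (basisVec k I) = 0) :
    pointwiseSum k S T (basisVec k I) = T L (basisVec k I) := by
  rw [pointwiseSum_basisVec, finsum_eq_single _ L]
  · exact finsum_eq_single _ hL fun h' hne => absurd rfl hne
  · intro M hM
    by_cases hMS : M ∈ S
    · simp [h M hMS hM]
    · simp [hMS]

theorem pointwiseSum_basisVec_eq_zero {S : Set (Finset E)}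
    {T : Finset E → Module.End k (VSpace k H)}
    {I : ProperIdeal H} (h : ∀ M ∈ S, T M (basisVec k I) = 0) :
    pointwiseSum k S T (basisVec k I) = 0 := by
  rw [pointwiseSum_basisVec]
  exact finsum_mem_eq_zero_of_forall_eq_zero h

variable [Fintype P]

open Classical in
/-- The operator of degree `v`, which maps `v_I` to `± v_J` if `J.height = I.height + v`. -/
def shiftOp (k : Type*) [Field k] (H : FullHeap A E) (arrow : P → P → Prop) (v : P → ℤ) :
    Module.End k (VSpace k H) :=
  Finsupp.linearCombination k fun I : ProperIdeal H =>
    if h : ∃ J : ProperIdeal H, J.height = I.height + v then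
      (shiftSign arrow I h.choose : ℤ) • basisVec k h.choose else 0

theorem shiftOp_basisVec {v : P → ℤ} {I J : ProperIdeal H} (h : J.height = I.height + v) :
    shiftOp k H arrow v (basisVec k I) = (shiftSign arrow I J : ℤ) • basisVec k J := by
  have h' : ∃ J : ProperIdeal H, J.height = I.height + v := ⟨J, h⟩
  have : h'.choose = J := ProperIdeal.height_injective (h'.choose_spec.trans h.symm)
  rw [shiftOp, basisVec, Finsupp.linearCombination_single, one_smul, dif_pos h', this]

theorem shiftOp_basisVec_of_not {v : P → ℤ} {I : ProperIdeal H}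
    (h : ¬ ∃ J : ProperIdeal H, J.height = I.height + v) :
    shiftOp k H arrow v (basisVec k I) = 0 := by
  rw [shiftOp, basisVec, Finsupp.linearCombination_single, one_smul, dif_neg h]

theorem shiftOp_basisVec_apply (v : P → ℤ) (I J : ProperIdeal H) :
    shiftOp k H arrow v (basisVec k I) J =
      if J.height = I.height + v then ((shiftSign arrow I J : ℤ) : k) else 0 := by
  split_ifs with h
  · rw [shiftOp_basisVec h]
    simp [basisVec]
  · by_cases h' : ∃ K : ProperIdeal H, K.height = I.height + v
    · obtain ⟨K, hK⟩ := h'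
      have hne : K ≠ J := by
        rintro rfl
        exact h hK
      rw [shiftOp_basisVec hK]
      simp [basisVec, hne]
    · rw [shiftOp_basisVec_of_not h']
      rfl

/-- The diagonal operator with eigenvalue `⟨weight I, v⟩` on `v_I`. -/
def weightOp (k : Type*) [Field k] (H : FullHeap A E) (v : P → ℤ) :
    Module.End k (VSpace k H) :=
  Finsupp.linearCombination k fun I : ProperIdeal H => (I.weight ⬝ᵥ v) • basisVec k I

theorem weightOp_basisVec (v : P → ℤ) (I : ProperIdeal H) :
    weightOp k H v (basisVec k I) = (I.weight ⬝ᵥ v) • basisVec k I := by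
  simp [weightOp, basisVec]

theorem lie_weightOp_weightOp (v w : P → ℤ) : ⁅weightOp k H v, weightOp k H w⁆ = 0 := by
  refine hom_ext_basisVec fun I => ?_
  rw [end_lie_apply, weightOp_basisVec, weightOp_basisVec, map_zsmul, map_zsmul,
    weightOp_basisVec, weightOp_basisVec, smul_comm, sub_self, LinearMap.zero_apply]

theorem asymmetry_flip (hA : IsGeneralizedCartanMatrix A) (hsl : A.IsSimplyLaced)
    (ho : IsOrientation A arrow) (v w : P → ℤ) :
    asymmetry (sgn arrow) w v = asymmetry (sgn arrow) v w * (-1) ^ (v ⬝ᵥ A *ᵥ w) := by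
  rw [← asymmetry_mul_flip hA hsl ho, ← mul_assoc, Int.units_mul_self, one_mul]

variable [DecidableEq P]

theorem Addable.weight_dotProduct (hA : IsGeneralizedCartanMatrix A) (hs : A.IsSymm)
    {χ : P → ℕ} (hχ : IsRealRoot A (fun p => (χ p : ℤ))) {I : ProperIdeal H} {L : Finset E}
    (h : Addable L I) (hL : L ∈ heapsOfCharacter H χ) :
    I.weight ⬝ᵥ (fun p => (χ p : ℤ)) = -1 :=
  (hχ.exists_height_iff hA hs I).1 ⟨_, h.height_union_eq hL⟩

theorem Removable.weight_dotProduct (hA : IsGeneralizedCartanMatrix A) (hs : A.IsSymm)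
    {χ : P → ℕ} (hχ : IsRealRoot A (fun p => (χ p : ℤ))) {I : ProperIdeal H} {L : Finset E}
    (h : Removable L I) (hL : L ∈ heapsOfCharacter H χ) :
    I.weight ⬝ᵥ (fun p => (χ p : ℤ)) = 1 := by
  have := ((hχ.neg hA).exists_height_iff hA hs I).1
    ⟨_, (h.height_sdiff_eq hL).trans (sub_eq_add_neg _ _)⟩
  rw [dotProduct_neg] at this
  linarith

theorem Addable.eq_of_height {χ : P → ℕ} {I J : ProperIdeal H} {L : Finset E}
    (h : Addable L I) (hL : L ∈ heapsOfCharacter H χ)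
    (hJ : J.height = I.height + fun p => (χ p : ℤ)) : L = idealDiff I J := by
  rw [h.eq_idealDiff]
  congr 1
  exact ProperIdeal.height_injective ((h.height_union_eq hL).trans hJ.symm)

theorem Removable.eq_of_height {χ : P → ℕ} {I J : ProperIdeal H} {L : Finset E}
    (h : Removable L I) (hL : L ∈ heapsOfCharacter H χ)
    (hJ : J.height = I.height - fun p => (χ p : ℤ)) : L = idealDiff J I := by
  rw [h.eq_idealDiff]
  congr 1
  exact ProperIdeal.height_injective ((h.height_sdiff_eq hL).trans hJ.symm)

theorem mem_heapsOfCharacter_of_height_eq_sub {χ : P → ℕ} {I J : ProperIdeal H}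
    (hJ : J.height = I.height - fun p => (χ p : ℤ)) : idealDiff J I ∈ heapsOfCharacter H χ :=
  idealDiff_mem_heapsOfCharacter (by rw [hJ, sub_add_cancel])

theorem shiftOp_zero (ho : IsOrientation A arrow) : shiftOp k H arrow 0 = 1 :=
  hom_ext_basisVec fun I => by
    rw [shiftOp_basisVec (J := I) (by simp), shiftSign_self ho]
    simp

theorem charX_eq_shiftOp (ho : IsOrientation A arrow) (χ : P → ℕ) :
    charX k H arrow χ = shiftOp k H arrow (fun p => (χ p : ℤ)) := by
  refine hom_ext_basisVec fun I => ?_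
  by_cases h : ∃ J : ProperIdeal H, J.height = I.height + fun p => (χ p : ℤ)
  · obtain ⟨J, hJ⟩ := h
    have hle := le_of_height_eq_add hJ
    rw [shiftOp_basisVec hJ, charX,
      pointwiseSum_basisVec_eq (idealDiff_mem_heapsOfCharacter hJ), LinearMap.smul_apply,
      opX_basisVec (addable_idealDiff hle), union_idealDiff hle, shiftSign_of_le ho hle]
    intro M hM hne
    rw [LinearMap.smul_apply, opX_basisVec_of_not fun hadd => hne (hadd.eq_of_height hM hJ),
      smul_zero]
  · rw [shiftOp_basisVec_of_not h, charX, pointwiseSum_basisVec_eq_zero]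
    intro M hM
    rw [LinearMap.smul_apply, opX_basisVec_of_not fun hadd => h ⟨_, hadd.height_union_eq hM⟩,
      smul_zero]

theorem charY_eq_shiftOp (hA : IsGeneralizedCartanMatrix A) (hsl : A.IsSimplyLaced)
    (ho : IsOrientation A arrow) {χ : P → ℕ} (hχ : IsRealRoot A (fun p => (χ p : ℤ))) :
    charY k H arrow χ = -shiftOp k H arrow (-fun p => (χ p : ℤ)) := by
  refine hom_ext_basisVec fun I => ?_
  rw [LinearMap.neg_apply]
  by_cases h : ∃ J : ProperIdeal H, J.height = I.height + -fun p => (χ p : ℤ)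
  · obtain ⟨J, hJ⟩ := h
    have hJ' := hJ.trans (sub_eq_add_neg _ _).symm
    have hle : J.height ≤ I.height := le_of_height_eq_add (by rw [hJ', sub_add_cancel])
    have hd : I.height - J.height = fun p => (χ p : ℤ) := by rw [hJ', sub_sub_cancel]
    rw [shiftOp_basisVec hJ, charY,
      pointwiseSum_basisVec_eq (mem_heapsOfCharacter_of_height_eq_sub hJ'), LinearMap.smul_apply,
      opY_basisVec (removable_idealDiff hle), sdiff_idealDiff hle, shiftSign_of_ge ho hle, hd,
      hχ.asymmetry_self hA hsl ho]
    · simp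
    · intro M hM hne
      rw [LinearMap.smul_apply, opY_basisVec_of_not fun hrem => hne (hrem.eq_of_height hM hJ'),
        smul_zero]
  · rw [shiftOp_basisVec_of_not h, charY, pointwiseSum_basisVec_eq_zero, neg_zero]
    intro M hM
    rw [LinearMap.smul_apply, opY_basisVec_of_not fun hrem =>
      h ⟨_, (hrem.height_sdiff_eq hM).trans (sub_eq_add_neg _ _)⟩, smul_zero]

theorem eq_singleton_of_mem_heapsOfCharacter {p : P} {L : Finset E}
    (hL : L ∈ heapsOfCharacter H (Pi.single p 1)) : ∃ x, L = {x} := by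
  rw [← Finset.card_eq_one, Finset.card_eq_sum_card_fiberwise (f := H.label) (t := Finset.univ)
    (by simp), Finset.sum_congr rfl fun q _ => hL.2 q]
  simp

theorem parity_eq_one_of_mem_heapsOfCharacter {p : P} {L : Finset E}
    (hL : L ∈ heapsOfCharacter H (Pi.single p 1)) : parity H arrow L = 1 := by
  obtain ⟨x, rfl⟩ := eq_singleton_of_mem_heapsOfCharacter hL
  simp [parity_eq_prod]

theorem vertexX_eq_charX (arrow : P → P → Prop) (p : P) :
    vertexX k H p = charX k H arrow (Pi.single p 1) := by
  refine hom_ext_basisVec fun I => ?_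
  rw [vertexX, charX, pointwiseSum_basisVec, pointwiseSum_basisVec]
  exact finsum_mem_congr rfl fun L hL => by rw [parity_eq_one_of_mem_heapsOfCharacter hL]; simp

theorem vertexY_eq_charY (arrow : P → P → Prop) (p : P) :
    vertexY k H p = charY k H arrow (Pi.single p 1) := by
  refine hom_ext_basisVec fun I => ?_
  rw [vertexY, charY, pointwiseSum_basisVec, pointwiseSum_basisVec]
  exact finsum_mem_congr rfl fun L hL => by rw [parity_eq_one_of_mem_heapsOfCharacter hL]; simp

theorem vertexX_eq_shiftOp (ho : IsOrientation A arrow) (p : P) :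
    vertexX k H p = shiftOp k H arrow (Pi.single p 1) := by
  rw [vertexX_eq_charX arrow, charX_eq_shiftOp ho, natCast_single]

theorem vertexY_eq_shiftOp (hA : IsGeneralizedCartanMatrix A) (hsl : A.IsSimplyLaced)
    (ho : IsOrientation A arrow) (p : P) :
    vertexY k H p = -shiftOp k H arrow (-Pi.single p 1) := by
  rw [vertexY_eq_charY arrow, charY_eq_shiftOp hA hsl ho, natCast_single]
  rw [natCast_single]
  exact IsRealRoot.single p

theorem charH_eq_weightOp (hA : IsGeneralizedCartanMatrix A) (hs : A.IsSymm)
    {χ : P → ℕ} (hχ : IsRealRoot A (fun p => (χ p : ℤ))) :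
    charH k H χ = weightOp k H (fun p => (χ p : ℤ)) := by
  classical
  refine hom_ext_basisVec fun I => ?_
  have hw := hχ.weight_dotProduct hA hs I
  rw [weightOp_basisVec, charH]
  have hadd : ∀ {L}, L ∈ heapsOfCharacter H χ → Addable L I → _ :=
    fun hL h => h.weight_dotProduct hA hs hχ hL
  have hrem : ∀ {L}, L ∈ heapsOfCharacter H χ → Removable L I → _ :=
    fun hL h => h.weight_dotProduct hA hs hχ hL
  have : I.weight ⬝ᵥ (fun p => (χ p : ℤ)) = -1 ∨ I.weight ⬝ᵥ (fun p => (χ p : ℤ)) = 0 ∨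
    I.weight ⬝ᵥ (fun p => (χ p : ℤ)) = 1 := by omega
  rcases this with h | h | h
  · obtain ⟨J, hJ⟩ := hχ.exists_height_eq_add hA hs I h
    have hmem := idealDiff_mem_heapsOfCharacter hJ
    rw [pointwiseSum_basisVec_eq hmem, opH_basisVec, h, if_neg, if_pos]
    · simp
    · exact ⟨addable_idealDiff (le_of_height_eq_add hJ), fun hr => by
        have := hrem hmem hr
        omega⟩
    · rintro ⟨hr, -⟩
      have := hrem hmem hr
      omega
    · intro M hM hne
      rw [opH_basisVec, if_neg, if_neg]
      · exact fun ha => hne (ha.1.eq_of_height hM hJ)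
      · rintro ⟨hr, -⟩
        have := hrem hM hr
        omega
  · rw [h, zero_smul, pointwiseSum_basisVec_eq_zero]
    intro M hM
    rw [opH_basisVec, if_neg, if_neg]
    · rintro ⟨ha, -⟩
      have := hadd hM ha
      omega
    · rintro ⟨hr, -⟩
      have := hrem hM hr
      omega
  · obtain ⟨J, hJ⟩ := (hχ.neg hA).exists_height_eq_add hA hs I (by rw [dotProduct_neg, h])
    rw [← sub_eq_add_neg] at hJ
    have hmem := mem_heapsOfCharacter_of_height_eq_sub hJ
    rw [pointwiseSum_basisVec_eq hmem, opH_basisVec, h, if_pos]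
    · simp
    · exact ⟨removable_idealDiff (le_of_height_eq_add (by rw [hJ, sub_add_cancel])), fun ha => by
        have := hadd hmem ha
        omega⟩
    · intro M hM hne
      rw [opH_basisVec, if_neg, if_neg]
      · rintro ⟨ha, -⟩
        have := hadd hM ha
        omega
      · exact fun hr => hne (hr.1.eq_of_height hM hJ)

theorem vertexH_eq_weightOp (hA : IsGeneralizedCartanMatrix A) (hs : A.IsSymm) (p : P) :
    vertexH k H p = weightOp k H (Pi.single p 1) := by
  have := charH_eq_weightOp (k := k) (H := H) hA hs (χ := Pi.single p 1) (by
    rw [natCast_single]; exact IsRealRoot.single p)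
  rwa [natCast_single] at this

theorem vertexH_basisVec (hA : IsGeneralizedCartanMatrix A) (hs : A.IsSymm) (p : P)
    (I : ProperIdeal H) : vertexH k H p (basisVec k I) = I.weight p • basisVec k I := by
  rw [vertexH_eq_weightOp hA hs, weightOp_basisVec, dotProduct_single_one]

/-! ### Commutation relations -/

theorem lie_weightOp_shiftOp (hA : IsGeneralizedCartanMatrix A) (v w : P → ℤ) :
    ⁅weightOp k H v, shiftOp k H arrow w⁆ = (v ⬝ᵥ A *ᵥ w) • shiftOp k H arrow w := by
  refine hom_ext_basisVec fun I => ?_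
  rw [end_lie_apply, weightOp_basisVec, map_zsmul, LinearMap.smul_apply]
  by_cases h : ∃ J : ProperIdeal H, J.height = I.height + w
  · obtain ⟨J, hJ⟩ := h
    rw [shiftOp_basisVec hJ, map_zsmul, weightOp_basisVec, I.weight_eq hA J, hJ,
      add_sub_cancel_left, add_dotProduct, dotProduct_comm (A *ᵥ w)]
    module
  · rw [shiftOp_basisVec_of_not h]
    simp

theorem shiftOp_shiftOp_basisVec (hA : IsGeneralizedCartanMatrix A) (hs : A.IsSymm)
    (ho : IsOrientation A arrow) {v w : P → ℤ} (hv : IsRealRoot A v) (hw : IsRealRoot A w)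
    (I : ProperIdeal H) :
    shiftOp k H arrow w (shiftOp k H arrow v (basisVec k I)) =
      if I.weight ⬝ᵥ v = -1 ∧ I.weight ⬝ᵥ w + v ⬝ᵥ A *ᵥ w = -1 then
        (asymmetry (sgn arrow) w v : ℤ) • shiftOp k H arrow (v + w) (basisVec k I) else 0 := by
  by_cases h1 : I.weight ⬝ᵥ v = -1
  · obtain ⟨J, hJ⟩ := hv.exists_height_eq_add hA hs I h1
    have hJw : J.weight ⬝ᵥ w = I.weight ⬝ᵥ w + v ⬝ᵥ A *ᵥ w := by
      rw [I.weight_eq hA J, hJ, add_sub_cancel_left, add_dotProduct, dotProduct_comm (A *ᵥ v),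
        dotProduct_mulVec_comm hs]
    rw [shiftOp_basisVec hJ, map_zsmul]
    by_cases h2 : I.weight ⬝ᵥ w + v ⬝ᵥ A *ᵥ w = -1
    · obtain ⟨K, hK⟩ := hw.exists_height_eq_add hA hs J (hJw.trans h2)
      rw [if_pos ⟨h1, h2⟩, shiftOp_basisVec hK,
        shiftOp_basisVec (I := I) (J := K) (by rw [hK, hJ, add_assoc]), smul_smul, smul_smul,
        ← Units.val_mul, ← Units.val_mul, shiftSign_mul ho, hK, add_sub_cancel_left, hJ,
        add_sub_cancel_left]
    · rw [if_neg fun h => h2 h.2, shiftOp_basisVec_of_not, smul_zero]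
      rw [hw.exists_height_iff hA hs, hJw]
      exact h2
  · rw [if_neg fun h => h1 h.1, shiftOp_basisVec_of_not, map_zero]
    rwa [hv.exists_height_iff hA hs]

theorem lie_shiftOp_shiftOp (hA : IsGeneralizedCartanMatrix A) (hsl : A.IsSimplyLaced)
    (ho : IsOrientation A arrow) {v w : P → ℤ} (hv : IsRealRoot A v) (hw : IsRealRoot A w)
    (h : v ⬝ᵥ A *ᵥ w = -1) :
    ⁅shiftOp k H arrow v, shiftOp k H arrow w⁆ =
      (asymmetry (sgn arrow) v w : ℤ) • shiftOp k H arrow (v + w) := by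
  have hs := isSymm_of_isSimplyLaced hA hsl
  refine hom_ext_basisVec fun I => ?_
  have hvI := hv.weight_dotProduct hA hs I
  have hwI := hw.weight_dotProduct hA hs I
  rw [end_lie_apply, shiftOp_shiftOp_basisVec hA hs ho hv hw,
    shiftOp_shiftOp_basisVec hA hs ho hw hv, asymmetry_flip hA hsl ho v w,
    dotProduct_mulVec_comm hs w v, h, add_comm w v, LinearMap.smul_apply]
  have hsum := (hv.add hA hs hw h).exists_height_iff hA hs I
  rw [dotProduct_add] at hsum
  by_cases h1 : I.weight ⬝ᵥ v + I.weight ⬝ᵥ w = -1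
  · have : (I.weight ⬝ᵥ v = -1 ∧ I.weight ⬝ᵥ w = 0) ∨ (I.weight ⬝ᵥ v = 0 ∧ I.weight ⬝ᵥ w = -1) := by
      omega
    rcases this with ⟨h2, h3⟩ | ⟨h2, h3⟩
    · simp [h2, h3]
    · simp [h2, h3]
  · rw [if_neg (by omega), if_neg (by omega), shiftOp_basisVec_of_not fun h => h1 (hsum.1 h)]
    simp

theorem lie_shiftOp_shiftOp_of_nonneg (hA : IsGeneralizedCartanMatrix A) (hsl : A.IsSimplyLaced)
    (ho : IsOrientation A arrow) {v w : P → ℤ} (hv : IsRealRoot A v) (hw : IsRealRoot A w)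
    (h : 0 ≤ v ⬝ᵥ A *ᵥ w) : ⁅shiftOp k H arrow v, shiftOp k H arrow w⁆ = 0 := by
  have hs := isSymm_of_isSimplyLaced hA hsl
  refine hom_ext_basisVec fun I => ?_
  have hvI := hv.weight_dotProduct hA hs I
  have hwI := hw.weight_dotProduct hA hs I
  rw [end_lie_apply, shiftOp_shiftOp_basisVec hA hs ho hv hw,
    shiftOp_shiftOp_basisVec hA hs ho hw hv, asymmetry_flip hA hsl ho v w,
    dotProduct_mulVec_comm hs w v, add_comm w v, LinearMap.zero_apply]
  rcases h.eq_or_lt with h | h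
  · simp [← h, and_comm]
  · rw [if_neg (by omega), if_neg (by omega), sub_zero]

theorem lie_shiftOp_shiftOp_neg (hA : IsGeneralizedCartanMatrix A) (hsl : A.IsSimplyLaced)
    (ho : IsOrientation A arrow) {v : P → ℤ} (hv : IsRealRoot A v) :
    ⁅shiftOp k H arrow v, shiftOp k H arrow (-v)⁆ = -weightOp k H v := by
  have hs := isSymm_of_isSimplyLaced hA hsl
  refine hom_ext_basisVec fun I => ?_
  have hvI := hv.weight_dotProduct hA hs I
  rw [end_lie_apply, shiftOp_shiftOp_basisVec hA hs ho hv (hv.neg hA),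
    shiftOp_shiftOp_basisVec hA hs ho (hv.neg hA) hv, asymmetry_neg_left, asymmetry_neg_right,
    hv.asymmetry_self hA hsl ho, neg_add_cancel, add_neg_cancel, shiftOp_zero ho,
    Matrix.mulVec_neg, dotProduct_neg, neg_dotProduct, dotProduct_neg, hv.norm_eq_two hA hs,
    LinearMap.neg_apply, weightOp_basisVec]
  have : I.weight ⬝ᵥ v = -1 ∨ I.weight ⬝ᵥ v = 0 ∨ I.weight ⬝ᵥ v = 1 := by omega
  rcases this with h | h | h <;> simp [h]

theorem shiftOp_ne_zero (hA : IsGeneralizedCartanMatrix A) (hs : A.IsSymm)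
    (hc : (dynkinGraph A).Connected) {v : P → ℤ} (hv : IsRealRoot A v) :
    shiftOp k H arrow v ≠ 0 := by
  obtain ⟨I, hI⟩ := hv.exists_weight_dotProduct_eq H hA hs hc
  obtain ⟨J, hJ⟩ := hv.exists_height_eq_add hA hs I hI
  intro h
  have h1 := congrFun (congrArg DFunLike.coe h) (basisVec k I)
  rw [shiftOp_basisVec hJ, LinearMap.zero_apply] at h1
  have h2 := congrFun (congrArg DFunLike.coe h1) J
  rcases Int.units_eq_one_or (shiftSign arrow I J) with h3 | h3 <;> simp [h3, basisVec] at h2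

end Operators

section Representation

variable {P : Type*} [Fintype P] [DecidableEq P] {A : Matrix P P ℤ} {E : Type*} [PartialOrder E]
  [LocallyFiniteOrder E] {H : FullHeap A E} {arrow : P → P → Prop} {o : P}

theorem weightOp_extend {k : Type*} [Field k] (hA : IsGeneralizedCartanMatrix A) (hs : A.IsSymm)
    (v : {p : P // p ≠ o} → ℤ) :
    weightOp k H (extend o v) = ∑ i, v i • vertexH k H i.1 := by
  refine hom_ext_basisVec fun I => ?_
  rw [weightOp_basisVec, dotProduct_extend, LinearMap.sum_apply, Finset.sum_smul]
  refine Finset.sum_congr rfl fun i _ => ?_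
  rw [LinearMap.smul_apply, vertexH_basisVec hA hs, smul_smul, mul_comm]

/-- The action of the Cartan subalgebra on `V_E`. -/
def cartanOp (H : FullHeap A E) (o : P) : ({p : P // p ≠ o} → ℂ) →ₗ[ℂ] Module.End ℂ (VSpace ℂ H) :=
  Fintype.linearCombination ℂ fun i : {p : P // p ≠ o} => vertexH ℂ H i.1

theorem cartanOp_apply (h : {p : P // p ≠ o} → ℂ) :
    cartanOp H o h = ∑ i, h i • vertexH ℂ H i.1 := Fintype.linearCombination_apply ..

/-- The action of the simple Lie algebra on `V_E`. -/
def heapRep (H : FullHeap A E) (arrow : P → P → Prop) (o : P) :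
    ChevalleySpace (deleteVertex A o) →ₗ[ℂ] Module.End ℂ (VSpace ℂ H) :=
  (cartanOp H o).coprod
    (Finsupp.linearCombination ℂ fun β : RealRoot (deleteVertex A o) =>
      shiftOp ℂ H arrow (extend o β.1))

theorem heapRep_apply (x : ChevalleySpace (deleteVertex A o)) :
    heapRep H arrow o x = cartanOp H o x.1 +
      x.2.sum fun β c => c • shiftOp ℂ H arrow (extend o β.1) := rfl

theorem heapRep_rootE (β : RealRoot (deleteVertex A o)) :
    heapRep H arrow o (rootE β) = shiftOp ℂ H arrow (extend o β.1) := by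
  simp [heapRep_apply, rootE]

theorem cartanOp_intCast (hA : IsGeneralizedCartanMatrix A) (hs : A.IsSymm)
    (v : {p : P // p ≠ o} → ℤ) :
    cartanOp H o (fun i => (v i : ℂ)) = weightOp ℂ H (extend o v) := by
  rw [weightOp_extend hA hs, cartanOp_apply]
  simp only [end_intCast_smul]

theorem lie_cartanOp_cartanOp (hA : IsGeneralizedCartanMatrix A) (hs : A.IsSymm)
    (h h' : {p : P // p ≠ o} → ℂ) : ⁅cartanOp H o h, cartanOp H o h'⁆ = 0 := by
  simp only [cartanOp_apply, sum_lie, lie_sum, end_smul_lie, end_lie_smul, vertexH_eq_weightOp hA hs,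
    lie_weightOp_weightOp, smul_zero, Finset.sum_const_zero]

theorem lie_cartanOp_shiftOp (hA : IsGeneralizedCartanMatrix A) (hs : A.IsSymm)
    (h : {p : P // p ≠ o} → ℂ) (β : RealRoot (deleteVertex A o)) :
    ⁅cartanOp H o h, shiftOp ℂ H arrow (extend o β.1)⁆ =
      rootEval (deleteVertex A o) β h • shiftOp ℂ H arrow (extend o β.1) := by
  rw [cartanOp_apply, sum_lie, rootEval, Finset.sum_smul]
  refine Finset.sum_congr rfl fun i _ => ?_
  rw [end_smul_lie, vertexH_eq_weightOp hA hs, lie_weightOp_shiftOp hA, single_one_dotProduct,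
    mulVec_extend, mul_smul, end_intCast_smul]

theorem heapRep_rootBracket (hA : IsGeneralizedCartanMatrix A) (hsl : A.IsSimplyLaced)
    (ho : IsOrientation A arrow) (hpd : IsPosDefOnLattice (deleteVertex A o))
    (α β : RealRoot (deleteVertex A o)) :
    heapRep H arrow o (rootBracket (deleteVertex A o) (fun i j => sgn arrow i.1 j.1) α β) =
      ⁅shiftOp ℂ H arrow (extend o α.1), shiftOp ℂ H arrow (extend o β.1)⁆ := by
  have hs := isSymm_of_isSimplyLaced hA hsl
  have hA' := hA.deleteVertex o
  have hs' := deleteVertex_isSymm (o := o) hs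
  rw [rootBracket]
  split_ifs with h0 h
  · have hβ : extend o β.1 = -extend o α.1 := by
      rw [← extend_neg, eq_neg_of_add_eq_zero_right h0]
    rw [hβ, lie_shiftOp_shiftOp_neg hA hsl ho α.2.extend, ← cartanOp_intCast hA hs, ← map_neg,
      heapRep_apply, Finsupp.sum_zero_index, add_zero]
    rfl
  · have h1 : heapRep H arrow o (rootE ⟨_, h⟩) =
        shiftOp ℂ H arrow (extend o α.1 + extend o β.1) := by
      rw [← extend_add]
      exact heapRep_rootE _
    rw [map_smul, h1, lie_shiftOp_shiftOp hA hsl ho α.2.extend β.2.extend,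
      asymmetry_extend, end_intCast_smul]
    rw [extend_dotProduct_mulVec]
    exact dotProduct_eq_neg_one_of_add hA' hs' α.2 β.2 h
  · rw [map_zero, lie_shiftOp_shiftOp_of_nonneg hA hsl ho α.2.extend β.2.extend]
    rw [extend_dotProduct_mulVec]
    exact α.2.dotProduct_nonneg hA' hs' hpd β.2 h0 h

theorem heapRep_chevalleyBracket (hA : IsGeneralizedCartanMatrix A) (hsl : A.IsSimplyLaced)
    (ho : IsOrientation A arrow) (hpd : IsPosDefOnLattice (deleteVertex A o))
    (x y : ChevalleySpace (deleteVertex A o)) :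
    heapRep H arrow o (chevalleyBracket (deleteVertex A o) (fun i j => sgn arrow i.1 j.1) x y) =
      ⁅heapRep H arrow o x, heapRep H arrow o y⁆ := by
  have hs := isSymm_of_isSimplyLaced hA hsl
  have hlr : ∀ (h : {p : P // p ≠ o} → ℂ) (β : RealRoot (deleteVertex A o)),
      ⁅shiftOp ℂ H arrow (extend o β.1), cartanOp H o h⁆ =
        -(rootEval (deleteVertex A o) β h • shiftOp ℂ H arrow (extend o β.1)) := fun h β => by
    rw [← lie_cartanOp_shiftOp hA hs]
    simp only [end_lie_eq, neg_sub]
  rw [chevalleyBracket, map_add, map_sub]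
  simp only [Finsupp.sum, map_sum, map_smul, heapRep_rootE, heapRep_rootBracket hA hsl ho hpd]
  rw [heapRep_apply x, heapRep_apply y]
  simp only [Finsupp.sum, add_lie, lie_add, sum_lie, lie_sum, end_smul_lie, end_lie_smul,
    lie_cartanOp_cartanOp hA hs, lie_cartanOp_shiftOp hA hs, hlr, smul_smul, smul_neg,
    Finset.sum_neg_distrib, Finset.sum_add_distrib]
  rw [Finset.sum_comm (s := y.2.support) (t := x.2.support)]
  simp only [mul_comm (y.2 _) (x.2 _)]
  abel

theorem isGeneratorRep_heapRep (hA : IsGeneralizedCartanMatrix A) (hsl : A.IsSimplyLaced)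
    (ho : IsOrientation A arrow) (hpd : IsPosDefOnLattice (deleteVertex A o)) :
    IsGeneratorRep hA H arrow o (heapRep H arrow o) where
  map_bracket := heapRep_chevalleyBracket hA hsl ho hpd
  map_h i := by
    simp [heapRep_apply, coE, cartanOp]
  map_e i := by
    rw [heapRep_rootE, vertexX_eq_shiftOp ho, ← extend_single]
    rfl
  map_f i := by
    rw [map_neg, heapRep_rootE, vertexY_eq_shiftOp hA hsl ho, ← extend_single, ← extend_neg]
    rfl

theorem chevalleyBracket_rootE {Q : Type*} [Fintype Q] [DecidableEq Q] {A : Matrix Q Q ℤ}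
    (sg : Q → Q → ℤˣ) (α β : RealRoot A) :
    chevalleyBracket A sg (rootE α) (rootE β) = rootBracket A sg α β := by
  simp [chevalleyBracket, rootE, rootEval]

theorem IsRealRoot.ne_zero {Q : Type*} [Fintype Q] [DecidableEq Q] {A : Matrix Q Q ℤ}
    (hA : IsGeneralizedCartanMatrix A) (hs : A.IsSymm) {v : Q → ℤ} (hv : IsRealRoot A v) :
    v ≠ 0 := by
  rintro rfl
  simpa using hv.norm_eq_two hA hs

theorem IsGeneratorRep.map_rootE_add {hA : IsGeneralizedCartanMatrix A} (hs : A.IsSymm)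
    {φ : ChevalleySpace (deleteVertex A o) →ₗ[ℂ] Module.End ℂ (VSpace ℂ H)}
    (hφ : IsGeneratorRep hA H arrow o φ) (α β : RealRoot (deleteVertex A o))
    (h : IsRealRoot (deleteVertex A o) (α.1 + β.1)) :
    φ (rootE ⟨_, h⟩) = (asymmetry (fun i j : {p : P // p ≠ o} => sgn arrow i.1 j.1) α.1 β.1 : ℤ) •
      ⁅φ (rootE α), φ (rootE β)⁆ := by
  rw [← hφ.map_bracket, chevalleyBracket_rootE, rootBracket,
    if_neg (h.ne_zero (hA.deleteVertex o) (deleteVertex_isSymm hs)), dif_pos h, map_smul,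
    end_intCast_smul, smul_smul, ← Units.val_mul, Int.units_mul_self]
  simp

theorem IsGeneratorRep.unique {hA : IsGeneralizedCartanMatrix A} (hs : A.IsSymm)
    (hpd : IsPosDefOnLattice (deleteVertex A o))
    {φ ψ : ChevalleySpace (deleteVertex A o) →ₗ[ℂ] Module.End ℂ (VSpace ℂ H)}
    (hφ : IsGeneratorRep hA H arrow o φ) (hψ : IsGeneratorRep hA H arrow o ψ) : φ = ψ := by
  have hA' := hA.deleteVertex o
  have hs' := deleteVertex_isSymm (o := o) hs
  have hpos : ∀ {v} (hv : IsRealRoot (deleteVertex A o) v), 0 ≤ v →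
      φ (rootE ⟨v, hv⟩) = ψ (rootE ⟨v, hv⟩) ∧
        φ (rootE ⟨-v, hv.neg hA'⟩) = ψ (rootE ⟨-v, hv.neg hA'⟩) := by
    intro v hv h0
    refine hv.nonneg_induction hA' hs' hpd (motive := fun v =>
      ∀ hv : IsRealRoot (deleteVertex A o) v, φ (rootE ⟨v, hv⟩) = ψ (rootE ⟨v, hv⟩) ∧
        φ (rootE ⟨-v, hv.neg hA'⟩) = ψ (rootE ⟨-v, hv.neg hA'⟩)) ?_ ?_ h0 hv
    · intro i hv
      refine ⟨(hφ.map_e i).trans (hψ.map_e i).symm, ?_⟩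
      have := (hφ.map_f i).trans (hψ.map_f i).symm
      rw [map_neg, map_neg] at this
      exact neg_injective this
    · intro i v hv hiv h0 ih hiv'
      have hi : IsRealRoot (deleteVertex A o) (Pi.single i 1) := IsRealRoot.single i
      refine ⟨?_, ?_⟩
      · have h1 := hφ.map_rootE_add hs ⟨_, hi⟩ ⟨_, hv⟩ hiv
        have h2 := hψ.map_rootE_add hs ⟨_, hi⟩ ⟨_, hv⟩ hiv
        have h3 : φ (rootE ⟨_, hi⟩) = ψ (rootE ⟨_, hi⟩) := (hφ.map_e i).trans (hψ.map_e i).symm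
        rw [h1, h2, (ih hv).1, h3]
      · have hneg : -(Pi.single i 1 + v) = -Pi.single i 1 + -v := neg_add _ _
        have hr : IsRealRoot (deleteVertex A o) (-Pi.single i 1 + -v) := hneg ▸ hiv.neg hA'
        have h1 := hφ.map_rootE_add hs ⟨_, hi.neg hA'⟩ ⟨_, hv.neg hA'⟩ hr
        have h2 := hψ.map_rootE_add hs ⟨_, hi.neg hA'⟩ ⟨_, hv.neg hA'⟩ hr
        have h3 : φ (rootE ⟨_, hi.neg hA'⟩) = ψ (rootE ⟨_, hi.neg hA'⟩) := by
          have := (hφ.map_f i).trans (hψ.map_f i).symm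
          rw [map_neg, map_neg] at this
          exact neg_injective this
        have h4 : (⟨-(Pi.single i 1 + v), hiv'.neg hA'⟩ : RealRoot (deleteVertex A o)) =
          ⟨_, hr⟩ := Subtype.ext hneg
        rw [h4, h1, h2, (ih hv).2, h3]
  have hroot : ∀ β : RealRoot (deleteVertex A o), φ (rootE β) = ψ (rootE β) := by
    rintro ⟨v, hv⟩
    rcases hv.nonneg_or_nonpos hA' hs' hpd with h0 | h0
    · exact (hpos hv h0).1
    · have h1 := (hpos (hv.neg hA') (neg_nonneg.2 h0)).2
      have h2 : (⟨- -v, (hv.neg hA').neg hA'⟩ : RealRoot (deleteVertex A o)) = ⟨v, hv⟩ :=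
        Subtype.ext (neg_neg v)
      rwa [h2] at h1
  refine LinearMap.prod_ext (LinearMap.pi_ext' fun i => LinearMap.ext_ring ?_)
    (Finsupp.lhom_ext' fun β => LinearMap.ext_ring (hroot β))
  exact (hφ.map_h i).trans (hψ.map_h i).symm

theorem cartanOp_basisVec (hA : IsGeneralizedCartanMatrix A) (hs : A.IsSymm)
    (h : {p : P // p ≠ o} → ℂ) (I : ProperIdeal H) :
    cartanOp H o h (basisVec ℂ I) = (∑ i, h i * (I.weight i.1 : ℤ)) • basisVec ℂ I := by
  rw [cartanOp_apply, LinearMap.sum_apply, Finset.sum_smul]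
  refine Finset.sum_congr rfl fun i _ => ?_
  rw [LinearMap.smul_apply, vertexH_basisVec hA hs, mul_smul, Int.cast_smul_eq_zsmul]

theorem det_ne_zero_of_isPosDefOnLattice {Q : Type*} [Fintype Q] [DecidableEq Q]
    {A : Matrix Q Q ℤ} (hpd : IsPosDefOnLattice A) : A.det ≠ 0 := by
  intro h
  obtain ⟨v, hv, hAv⟩ := Matrix.exists_mulVec_eq_zero_iff.2 h
  have := hpd v hv
  rw [hAv] at this
  simp at this

theorem cartanOp_injective (hA : IsGeneralizedCartanMatrix A) (hs : A.IsSymm)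
    (hc : (dynkinGraph A).Connected) (hpd : IsPosDefOnLattice (deleteVertex A o)) :
    Function.Injective (cartanOp H o) := by
  rw [injective_iff_map_eq_zero]
  intro h hh
  have hI : ∀ I : ProperIdeal H, ∑ i : {p : P // p ≠ o}, h i * (I.weight i.1 : ℤ) = 0 := fun I => by
    have h1 := cartanOp_basisVec hA hs h I
    rw [hh, LinearMap.zero_apply] at h1
    have h2 := congrFun (congrArg DFunLike.coe h1) I
    simpa [basisVec] using h2.symm
  have hdet : ((deleteVertex A o).map (Int.cast : ℤ → ℂ)).det ≠ 0 := by
    have := (Int.castRingHom ℂ).map_det (deleteVertex A o)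
    rw [RingHom.mapMatrix_apply] at this
    simp only [Int.coe_castRingHom] at this
    rw [← this]
    exact_mod_cast det_ne_zero_of_isPosDefOnLattice hpd
  refine Matrix.eq_zero_of_vecMul_eq_zero hdet ?_
  ext j
  obtain ⟨I, hIj⟩ := H.exists_weight_eq_neg_one hA hs hc j.1
  obtain ⟨J, hJ⟩ := I.exists_add_single hA hIj
  have h1 := hI J
  simp only [weight_of_height_eq_add_single hA hJ, Int.cast_add, mul_add,
    Finset.sum_add_distrib, hI I, zero_add] at h1
  exact h1

theorem heapRep_injective (hA : IsGeneralizedCartanMatrix A) (hs : A.IsSymm)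
    (hc : (dynkinGraph A).Connected) (hpd : IsPosDefOnLattice (deleteVertex A o)) :
    Function.Injective (heapRep H arrow o) := by
  rw [injective_iff_map_eq_zero]
  rintro ⟨h, f⟩ hx
  have hf : f = 0 := by
    ext β
    obtain ⟨I, hI⟩ := β.2.extend.exists_weight_dotProduct_eq H hA hs hc
    obtain ⟨J, hJ⟩ := β.2.extend.exists_height_eq_add hA hs I hI
    have hIJ : I ≠ J := by
      rintro rfl
      exact β.2.extend.ne_zero hA hs (by simpa using hJ)
    have h1 := congrFun (congrArg DFunLike.coe
      (congrFun (congrArg DFunLike.coe hx) (basisVec ℂ I))) J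
    rw [heapRep_apply, LinearMap.add_apply, cartanOp_basisVec hA hs, Finsupp.sum,
      LinearMap.sum_apply, Finsupp.add_apply, Finsupp.finsetSum_apply, Finset.sum_eq_single β] at h1
    · simp only [LinearMap.smul_apply, Finsupp.smul_apply, shiftOp_basisVec_apply, hJ, if_true]
        at h1
      have hbJ : (basisVec ℂ I : VSpace ℂ H) J = 0 := by
        rw [basisVec]
        exact Finsupp.single_eq_of_ne hIJ.symm
      simp only [hbJ, mul_zero, zero_add, smul_eq_mul,
        LinearMap.zero_apply, Finsupp.zero_apply, mul_eq_zero] at h1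
      rcases h1 with h1 | h1
      · exact h1
      · exact absurd h1 (by
          rcases Int.units_eq_one_or (shiftSign arrow I J) with h3 | h3 <;> simp [h3])
    · intro γ _ hγ
      rw [LinearMap.smul_apply, Finsupp.smul_apply, shiftOp_basisVec_apply, if_neg, smul_zero]
      rw [hJ, add_right_inj]
      exact fun h => hγ (Subtype.ext (extend_injective h).symm)
    · intro hβ
      rw [Finsupp.notMem_support_iff] at hβ
      simp [hβ]
  subst hf
  have : cartanOp H o h = 0 := by simpa [heapRep_apply] using hx
  rw [← map_zero (cartanOp H o)] at this
  rw [cartanOp_injective hA hs hc hpd this]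
  rfl

end Representation

section Generation

variable {P : Type*} [Fintype P] [DecidableEq P] {A : Matrix P P ℤ} {E : Type*} [PartialOrder E]
  [LocallyFiniteOrder E] {H : FullHeap A E} {arrow : P → P → Prop} {o : P} {k : Type*} [Field k]

theorem shiftOp_add_mem {S : LieSubalgebra k (Module.End k (VSpace k H))}
    (hA : IsGeneralizedCartanMatrix A) (hsl : A.IsSimplyLaced)
    (ho : IsOrientation A arrow) {v w : P → ℤ} (hv : IsRealRoot A v) (hw : IsRealRoot A w)
    (hvw : IsRealRoot A (v + w)) (hvS : shiftOp k H arrow v ∈ S) (hwS : shiftOp k H arrow w ∈ S) :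
    shiftOp k H arrow (v + w) ∈ S := by
  have h := lie_shiftOp_shiftOp (k := k) (H := H) hA hsl ho hv hw
    (dotProduct_eq_neg_one_of_add hA (isSymm_of_isSimplyLaced hA hsl) hv hw hvw)
  have h1 : ⁅shiftOp k H arrow v, shiftOp k H arrow w⁆ ∈ S := S.lie_mem hvS hwS
  rw [h] at h1
  rcases Int.units_eq_one_or (asymmetry (sgn arrow) v w) with h2 | h2
  · simpa [h2] using h1
  · rw [h2, Units.val_neg, Units.val_one, neg_one_zsmul] at h1
    exact neg_mem_iff.1 h1

theorem shiftOp_mem_of_nonneg {S : LieSubalgebra k (Module.End k (VSpace k H))}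
    (hA : IsGeneralizedCartanMatrix A) (hsl : A.IsSimplyLaced)
    (ho : IsOrientation A arrow) (hpd : IsPosDefOnLattice (deleteVertex A o))
    (hS : ∀ p, shiftOp k H arrow (Pi.single p 1) ∈ S)
    {v : {p : P // p ≠ o} → ℤ} (hv : IsRealRoot (deleteVertex A o) v) (h0 : 0 ≤ v) :
    shiftOp k H arrow (extend o v) ∈ S := by
  refine hv.nonneg_induction (hA.deleteVertex o)
    (deleteVertex_isSymm (isSymm_of_isSimplyLaced hA hsl)) hpd
    (motive := fun v => shiftOp k H arrow (extend o v) ∈ S) ?_ ?_ h0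
  · intro i
    rw [extend_single]
    exact hS i.1
  · intro i v hv hiv _ ih
    have h := hiv.extend
    rw [extend_add, extend_single] at h ⊢
    exact shiftOp_add_mem hA hsl ho (IsRealRoot.single i.1) hv.extend h (hS i.1) ih

theorem shiftOp_neg_mem_of_nonneg {S : LieSubalgebra k (Module.End k (VSpace k H))}
    (hA : IsGeneralizedCartanMatrix A) (hsl : A.IsSimplyLaced)
    (ho : IsOrientation A arrow) (hpd : IsPosDefOnLattice (deleteVertex A o))
    (hS : ∀ p, shiftOp k H arrow (-Pi.single p 1) ∈ S)
    {v : {p : P // p ≠ o} → ℤ} (hv : IsRealRoot (deleteVertex A o) v) (h0 : 0 ≤ v) :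
    shiftOp k H arrow (-extend o v) ∈ S := by
  refine hv.nonneg_induction (hA.deleteVertex o)
    (deleteVertex_isSymm (isSymm_of_isSimplyLaced hA hsl)) hpd
    (motive := fun v => shiftOp k H arrow (-extend o v) ∈ S) ?_ ?_ h0
  · intro i
    rw [extend_single]
    exact hS i.1
  · intro i v hv hiv _ ih
    have h := hiv.extend.neg hA
    rw [extend_add, extend_single, neg_add] at h ⊢
    exact shiftOp_add_mem hA hsl ho ((IsRealRoot.single i.1).neg hA) (hv.extend.neg hA) h
      (hS i.1) ih

theorem charX_extendByZero (ho : IsOrientation A arrow) (α : {p : P // p ≠ o} → ℕ) :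
    charX k H arrow (extendByZero o α) = shiftOp k H arrow (extend o fun i => (α i : ℤ)) := by
  rw [charX_eq_shiftOp ho, extend_natCast]

theorem charY_extendByZero (hA : IsGeneralizedCartanMatrix A) (hsl : A.IsSimplyLaced)
    (ho : IsOrientation A arrow) {α : {p : P // p ≠ o} → ℕ}
    (hα : IsRealRoot (deleteVertex A o) (fun i => (α i : ℤ))) :
    charY k H arrow (extendByZero o α) = -shiftOp k H arrow (-extend o fun i => (α i : ℤ)) := by
  rw [charY_eq_shiftOp hA hsl ho, extend_natCast]
  rw [extend_natCast]
  exact hα.extend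

end Generation

end FullHeapRep

end

open FullHeapRep in
theorem proposition5p4
    {P : Type*} [Fintype P] [DecidableEq P] {A : Matrix P P ℤ}
    (hA : IsGeneralizedCartanMatrix A) (hsl : A.IsSimplyLaced) (haff : IsAffineType A)
    {δ : P → ℤ} (hδ : IsNullRoot A δ) {o : P} (ho : δ o = 1)
    {E : Type*} [PartialOrder E] [LocallyFiniteOrder E] (H : FullHeap A E)
    {arrow : P → P → Prop} (harrow : IsOrientation A arrow)
    {k : Type*} [Field k] (hk : (2 : k) ≠ 0)
    (α : {p : P // p ≠ o} → ℕ)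
    (hα : IsRealRoot (deleteVertex A o) (fun i => (α i : ℤ))) :
    -- the root is representable
    (heapsOfCharacter H (extendByZero o α)).Nonempty ∧
    -- `X_α` is nonzero and lies in the Lie algebra generated by the `X_p`
    (charX k H arrow (extendByZero o α) ≠ 0 ∧
      charX k H arrow (extendByZero o α) ∈
        LieSubalgebra.lieSpan k (Module.End k (VSpace k H)) (Set.range (vertexX k H))) ∧
    -- `[H_p, X_α] = ⟨α, α_p^∨⟩ X_α` for all vertices `p`
    (∀ p : P, ⁅vertexH k H p, charX k H arrow (extendByZero o α)⁆ =
      A.mulVec (fun q => (extendByZero o α q : ℤ)) p • charX k H arrow (extendByZero o α)) ∧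
    -- `Y_α` is nonzero and lies in the Lie algebra generated by the `Y_p`
    (charY k H arrow (extendByZero o α) ≠ 0 ∧
      charY k H arrow (extendByZero o α) ∈
        LieSubalgebra.lieSpan k (Module.End k (VSpace k H)) (Set.range (vertexY k H))) ∧
    -- `[H_p, Y_α] = -⟨α, α_p^∨⟩ Y_α` for all vertices `p`
    (∀ p : P, ⁅vertexH k H p, charY k H arrow (extendByZero o α)⁆ =
      -(A.mulVec (fun q => (extendByZero o α q : ℤ)) p) •
        charY k H arrow (extendByZero o α)) ∧
    -- over the complex numbers `X_α = E_α` and `Y_α = -E_{-α}`, under the unique representation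
    -- by which the Chevalley generators act as `X_i`, `Y_i`, `H_i`; it is faithful
    (∃ ψ : ChevalleySpace (deleteVertex A o) →ₗ[ℂ] Module.End ℂ (VSpace ℂ H),
      IsGeneratorRep hA H arrow o ψ ∧
      (∀ φ, IsGeneratorRep hA H arrow o φ → φ = ψ) ∧
      Function.Injective ψ ∧
      ψ (rootE ⟨fun i => (α i : ℤ), hα⟩) = charX ℂ H arrow (extendByZero o α) ∧
      ψ (-rootE (RealRoot.neg (hA.deleteVertex o) ⟨fun i => (α i : ℤ), hα⟩)) =
        charY ℂ H arrow (extendByZero o α)) ∧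
    -- no proper ideal admits both adding and removing a root heap of character `α`
    (∀ I : ProperIdeal H, ¬ ∃ L ∈ heapsOfCharacter H (extendByZero o α),
      ∃ L' ∈ heapsOfCharacter H (extendByZero o α), Addable L I ∧ Removable L' I) ∧
    -- `H_α = ∑ λ_i H_i`, and this is the operator of the coroot `α^∨ = w α_i^∨` for `α = w α_i`
    (charH k H (extendByZero o α) = ∑ i, (α i : ℤ) • vertexH k H i.1 ∧
      ∀ c, IsCorootOf (deleteVertex A o) (fun i => (α i : ℤ)) c →
        charH k H (extendByZero o α) = ∑ i, c i • vertexH k H i.1) := by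
  have hs := isSymm_of_isSimplyLaced hA hsl
  have hpd := isPosDefOnLattice_deleteVertex hA hs haff.connected hδ o
  have h0 : (0 : {p : P // p ≠ o} → ℤ) ≤ fun i => (α i : ℤ) := fun i => Int.natCast_nonneg _
  have hext := extend_natCast (o := o) α
  have hroot : IsRealRoot A (fun p => (extendByZero o α p : ℤ)) := by
    rw [hext]
    exact hα.extend
  have hH : charH k H (extendByZero o α) = ∑ i, (α i : ℤ) • vertexH k H i.1 := by
    rw [charH_eq_weightOp hA hs hroot, hext, weightOp_extend hA hs]
  refine ⟨?_, ⟨?_, ?_⟩, ?_, ⟨?_, ?_⟩, ?_, ?_, ?_, hH, ?_⟩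
  · obtain ⟨I, hI⟩ := hroot.exists_weight_dotProduct_eq H hA hs haff.connected
    obtain ⟨J, hJ⟩ := hroot.exists_height_eq_add hA hs I hI
    exact ⟨_, idealDiff_mem_heapsOfCharacter hJ⟩
  · rw [charX_extendByZero harrow]
    exact shiftOp_ne_zero hA hs haff.connected hα.extend
  · rw [charX_extendByZero harrow]
    refine shiftOp_mem_of_nonneg hA hsl harrow hpd (fun p => ?_) hα h0
    rw [← vertexX_eq_shiftOp harrow]
    exact LieSubalgebra.subset_lieSpan ⟨p, rfl⟩
  · intro p
    rw [charX_extendByZero harrow, vertexH_eq_weightOp hA hs, lie_weightOp_shiftOp hA, hext,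
      single_one_dotProduct]
  · rw [charY_extendByZero hA hsl harrow hα]
    exact end_neg_ne_zero (shiftOp_ne_zero hA hs haff.connected (hα.extend.neg hA))
  · rw [charY_extendByZero hA hsl harrow hα]
    refine neg_mem (shiftOp_neg_mem_of_nonneg hA hsl harrow hpd (fun p => ?_) hα h0)
    rw [← neg_mem_iff, ← vertexY_eq_shiftOp hA hsl harrow]
    exact LieSubalgebra.subset_lieSpan ⟨p, rfl⟩
  · intro p
    rw [charY_extendByZero hA hsl harrow hα, vertexH_eq_weightOp hA hs, end_lie_neg, lie_weightOp_shiftOp hA, hext,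
      single_one_dotProduct, Matrix.mulVec_neg, Pi.neg_apply]
    exact (end_zsmul_neg _ _).symm
  · have hrep := isGeneratorRep_heapRep (H := H) (o := o) hA hsl harrow hpd
    refine ⟨_, hrep, fun φ hφ => hφ.unique hs hpd hrep,
      heapRep_injective hA hs haff.connected hpd, ?_, ?_⟩
    · rw [charX_extendByZero harrow]
      exact heapRep_rootE _
    · rw [charY_extendByZero hA hsl harrow hα, map_neg, heapRep_rootE, ← extend_neg]
      rfl
  · rintro I ⟨L, hL, L', hL', hadd, hrem⟩
    have h1 := hadd.weight_dotProduct hA hs hroot hL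
    have h2 := hrem.weight_dotProduct hA hs hroot hL'
    omega
  · intro c hc
    rw [hH, hc.eq (deleteVertex_isSymm hs)]
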